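/- Let $\eta>0$, $a+\eta<b$, $\bar v>0$ and $\beta(t)=b+t\bar v$. \emph{Kernel.} Let $W\in C^1([0,\eta];[0,\infty))$ with $W'\le 0$ and $\int_0^\eta W=1$. \emph{Velocity.} Let $\rho^{\max}_\omega>0$ for every $\omega>0$, and let $v(\rho,\omega)\ge 0$ be a velocity function on $\{\omega>0,\ 0\le\rho\le\rho^{\max}_\omega\}$ that is jointly continuous, twice continuously differentiable in $\rho$, and, for $\rho<\rho^{\max}_\omega$, continuously differentiable in $\omega$. Let it satisfy $v(0,\omega)=\omega$, $v(\rho,0)=0$, $v(\rho^{\max}_\omega,\omega)=0$, $\partial_\rho^2(\rho v(\rho,\omega))<0$ for $\omega>0$, and $\partial_\omega v(\rho,\omega)>0$ for $\rho<\rho^{\max}_\omega$. For $\omega\ge\bar v$ let $\bar\rho(\omega)\in[0,\rho^{\max}_\omega]$ denote the equilibrium density, i.e. the solution of $v(\bar\rho(\omega),\omega)=\bar v$. \emph{Solution.} Let $(\rho_0,\omega_0)$ be initial data on $[a,b]$ with $\omega_0\ge\bar v$. Let $(\rho,\omega)$ solve the nonlocal GARZ system $$\partial_t\rho+\partial_x(\rho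 V)=0,\qquad \partial_t\omega+V\,\partial_x\omega=0,\qquad V(t,x)=\int_x^{x+\eta}W(y-x)\,v(\rho(t,y),\omega(t,y))\,dy,$$ for $t>0$, $a<x<\beta(t)$, with $(\rho,\omega)(0,\cdot)=(\rho_0,\omega_0)$ on $[a,b]$, $(\rho,\omega)(t,a)=(0,\omega_0(a))$ for $t>0$, and $(\rho,\omega)(t,y)=(\bar\rho(\omega_0(b)),\omega_0(b))$ for $t\ge 0$, $y\in[\beta(t),\beta(t)+\eta]$. Assume that \begin{itemize} \item $\rho\in C^1([0,\infty);H^2(\mathbb R))$ (values of $\rho$ outside $[a,\beta(t)+\eta]$ are an arbitrary extension), and the first equation holds pointwise; \item $\omega$ is continuous on $\{t\ge 0,\ a\le x\le\beta(t)\}$ and solves the second equation in the sense of characteristics, i.e. it is constant along every curve $X$ with $X'(t)=V(t,X(t))$, $t>0$, $a<X(t)<\beta(t)$ (as every classical solution is); \item $\omega>0$ and $0\le\rho\le\rho^{\max}_\omega$ for $t\ge0$, $a\le x\le\beta(t)$. \end{itemize} Let $v'_{\max}<0$ satisfy $\partial_\rho v(r,\omega_0(x))\le v'_{\max}$ for all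 $x\in[a,b]$ and $0\le r\le\rho^{\max}_{\omega_0(x)}$. Assume either a) $W\equiv 1/\eta$, or b) $W$ is concave, $\omega_0\equiv\omega_*$ is constant on $[b-\eta,b]$, and on $[b-\eta,b]$ either $\rho_0\ge\bar\rho(\omega_*)$ and $\rho_0$ is nonincreasing, or $\rho_0\le\bar\rho(\omega_*)$ and $\rho_0$ is nondecreasing. Put $\bar\rho(t,x)=\bar\rho(\omega(t,x))$, $c_\rho=\inf_{t\ge 0}\int_{\beta(t)-\eta}^{\beta(t)}\rho(t,x)\,dx$, $$\alpha(t)=\sup\Big\{x\in[\beta(t)-\eta,\beta(t)]:\int_x^{\beta(t)}\rho(t,y)\,dy\ge c_\rho\Big\},\qquad L(t)=\int_{\alpha(t)}^{\beta(t)}(\rho(t,x)-\bar\rho(t,x))^2\,dx,$$ and $\rho_{\min}=\inf_{x\in[\alpha(0),b]}\min\{\rho_0(x),\bar\rho(0,x)\}$. Then for all $t\ge 0$ $$L(t)\le L(0)\exp\Big(2\,v'_{\max}\,\rho_{\min}\int_0^t W(\beta(s)-\alpha(s))\,ds\Big).$$ -/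

import Mathlib

open MeasureTheory Set

noncomputable section

namespace NonlocalGARZ

/-- The space `L²(ℝ)`. -/
abbrev L2 : Type := Lp ℝ 2 (volume : Measure ℝ)

/-- `g` is the weak derivative of `f`, tested against smooth compactly supported functions. -/
def IsWeakDeriv (f g : L2) : Prop :=
  ∀ φ : ℝ → ℝ, ContDiff ℝ (⊤ : ℕ∞) φ → HasCompactSupport φ →
    ∫ x, f x * deriv φ x = -∫ x, g x * φ x

theorem integrable_mul_test (f : L2) {φ : ℝ → ℝ} (hc : Continuous φ)
    (hs : HasCompactSupport φ) : Integrable (fun x => f x * φ x) :=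
  MemLp.integrable_mul (p := 2) (q := 2) (Lp.memLp f) (hc.memLp_of_hasCompactSupport hs)

theorem integral_add_mul_test (f g : L2) {φ : ℝ → ℝ} (hc : Continuous φ)
    (hs : HasCompactSupport φ) :
    ∫ x, (f + g : L2) x * φ x = (∫ x, f x * φ x) + ∫ x, g x * φ x := by
  rw [← integral_add (integrable_mul_test f hc hs) (integrable_mul_test g hc hs)]
  refine integral_congr_ae ?_
  filter_upwards [Lp.coeFn_add f g] with x hx
  rw [hx, Pi.add_apply, add_mul]

theorem integral_smul_mul_test (c : ℝ) (f : L2) (φ : ℝ → ℝ) :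
    ∫ x, (c • f : L2) x * φ x = c * ∫ x, f x * φ x := by
  rw [← integral_const_mul]
  refine integral_congr_ae ?_
  filter_upwards [Lp.coeFn_smul c f] with x hx
  rw [hx, Pi.smul_apply, smul_eq_mul, mul_assoc]

theorem integral_zero_mul_test (φ : ℝ → ℝ) : ∫ x, (0 : L2) x * φ x = 0 := by
  simpa only [zero_smul, zero_mul] using integral_smul_mul_test 0 0 φ

theorem IsWeakDeriv.zero : IsWeakDeriv 0 0 := by
  intro φ _ _
  rw [integral_zero_mul_test, integral_zero_mul_test, neg_zero]

theorem IsWeakDeriv.add {f g f' g' : L2} (h : IsWeakDeriv f g) (h' : IsWeakDeriv f' g') :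
    IsWeakDeriv (f + f') (g + g') := by
  intro φ hφ hs
  rw [integral_add_mul_test f f' (hφ.continuous_deriv (by simp)) hs.deriv,
    integral_add_mul_test g g' hφ.continuous hs, h φ hφ hs, h' φ hφ hs]
  ring

theorem IsWeakDeriv.smul (c : ℝ) {f g : L2} (h : IsWeakDeriv f g) :
    IsWeakDeriv (c • f) (c • g) := by
  intro φ hφ hs
  rw [integral_smul_mul_test, integral_smul_mul_test, h φ hφ hs]
  ring

/-- The Sobolev space `H²(ℝ)`: an element is recorded as the triple `(f, f', f'')` of an `L²`
function and its first two weak derivatives. The norm is the maximum of the three `L²` norms,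
which is equivalent to the usual Hilbert norm of `H²(ℝ)`. -/
def H2 : Submodule ℝ (L2 × L2 × L2) where
  carrier := {u | IsWeakDeriv u.1 u.2.1 ∧ IsWeakDeriv u.2.1 u.2.2}
  add_mem' hu hw := ⟨hu.1.add hw.1, hu.2.add hw.2⟩
  zero_mem' := ⟨IsWeakDeriv.zero, IsWeakDeriv.zero⟩
  smul_mem' c _ hu := ⟨hu.1.smul c, hu.2.smul c⟩

/-- `ρ ∈ C¹([0,∞); H²(ℝ))`, where every `ρ t` is the continuous representative of its class. -/
def IsC1H2 (ρ : ℝ → ℝ → ℝ) : Prop :=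
  (∀ t, 0 ≤ t → Continuous (ρ t)) ∧
    ∃ u : ℝ → H2, ContDiffOn ℝ 1 u (Ici 0) ∧ ∀ t, 0 ≤ t → ρ t =ᵐ[volume] ((u t : L2 × L2 × L2).1)

/-- The kernel `W ∈ C¹([0,η]; ℝ⁺)`: nonincreasing with unit mass. -/
structure IsKernel (η : ℝ) (W : ℝ → ℝ) : Prop where
  contDiff : ContDiffOn ℝ 1 W (Icc 0 η)
  nonneg : ∀ x ∈ Icc 0 η, 0 ≤ W x
  deriv_nonpos : ∀ x ∈ Icc 0 η, derivWithin W (Icc 0 η) x ≤ 0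
  integral_eq_one : ∫ x in (0 : ℝ)..η, W x = 1

/-- The velocity function `v(ρ, ω)`, considered for markers `ω > 0` and densities
`0 ≤ ρ ≤ ρmax ω`, where `ρmax ω > 0` is the maximal density: `v(ρmax ω, ω) = 0`.
The strict monotonicity in `ω` is required below the maximal density only; at the maximal
density it fails already for `v(ρ, ω) = ω (1 - ρ)`. -/
structure IsVelocity (v : ℝ → ℝ → ℝ) (ρmax : ℝ → ℝ) : Prop where
  rhoMax_pos : ∀ w, 0 < w → 0 < ρmax w
  apply_rhoMax : ∀ w, 0 < w → v (ρmax w) w = 0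
  nonneg : ∀ w, 0 < w → ∀ r ∈ Icc 0 (ρmax w), 0 ≤ v r w
  apply_zero_left : ∀ w, 0 ≤ w → v 0 w = w
  apply_zero_right : ∀ r, 0 ≤ r → v r 0 = 0
  continuous : ContinuousOn (fun p : ℝ × ℝ => v p.1 p.2)
    {p : ℝ × ℝ | 0 < p.2 ∧ 0 ≤ p.1 ∧ p.1 ≤ ρmax p.2}
  contDiff_density : ∀ w, 0 < w → ContDiffOn ℝ 2 (fun r => v r w) (Icc 0 (ρmax w))
  contDiff_marker : ∀ r, 0 ≤ r → ContDiffOn ℝ 1 (fun w => v r w) {w | 0 < w ∧ r < ρmax w}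
  flux_concave : ∀ w, 0 < w → ∀ r ∈ Icc 0 (ρmax w),
    iteratedDerivWithin 2 (fun s => s * v s w) (Icc 0 (ρmax w)) r < 0
  marker_increasing : ∀ r w, 0 ≤ r → 0 < w → r < ρmax w →
    0 < derivWithin (fun w' => v r w') {w' | 0 < w' ∧ r < ρmax w'} w

/-- The nonlocal velocity `V(t, x) = ∫_x^{x+η} W(y - x) v(ρ(t, y), ω(t, y)) dy`. -/
def nonlocalVelocity (η : ℝ) (W : ℝ → ℝ) (v : ℝ → ℝ → ℝ) (ρ ω : ℝ → ℝ → ℝ) (t x : ℝ) : ℝ :=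
  ∫ y in x..(x + η), W (y - x) * v (ρ t y) (ω t y)

/-- The position `β(t) = b + t v̄` of the leader. -/
def leader (b vbar t : ℝ) : ℝ := b + t * vbar

/-- The equilibrium density of the marker `w`: the (unique) density `r ∈ [0, ρmax w]` with
`v(r, w) = v̄`. -/
def eqDensity (v : ℝ → ℝ → ℝ) (ρmax : ℝ → ℝ) (vbar w : ℝ) : ℝ :=
  sSup {r | 0 ≤ r ∧ r ≤ ρmax w ∧ v r w = vbar}

/-- The transport equation `∂ₜω + V ∂ₓω = 0` for `t > 0`, `a < x < β(t)`, in the sense of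
characteristics: `ω` is constant along every curve `X` in this domain with `X' = V(t, X)`. -/
def IsTransported (a : ℝ) (β : ℝ → ℝ) (V ω : ℝ → ℝ → ℝ) : Prop :=
  ∀ (s T : ℝ) (X : ℝ → ℝ), 0 < s → s ≤ T →
    (∀ t ∈ Icc s T, a < X t ∧ X t < β t) →
    (∀ t ∈ Icc s T, HasDerivWithinAt X (V t (X t)) (Icc s T) t) →
    ω T (X T) = ω s (X s)

/-- Every classical solution of `∂ₜω + V ∂ₓω = 0` is a solution in the sense of
characteristics. -/
theorem IsTransported.of_classical {a : ℝ} {β : ℝ → ℝ} {V ω : ℝ → ℝ → ℝ}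
    (hd : ∀ t x, 0 < t → a < x → x < β t →
      DifferentiableAt ℝ (fun p : ℝ × ℝ => ω p.1 p.2) (t, x))
    (hω : ∀ t x, 0 < t → a < x → x < β t →
      deriv (fun s => ω s x) t + V t x * deriv (fun y => ω t y) x = 0) :
    IsTransported a β V ω := by
  intro s T X hs hsT hX hX'
  have key : ∀ t ∈ Icc s T, HasDerivWithinAt (fun t => ω t (X t)) 0 (Icc s T) t := by
    intro t ht
    obtain ⟨h1, h2⟩ := hX t ht
    have ht0 : 0 < t := lt_of_lt_of_le hs ht.1
    have hD := (hd t (X t) ht0 h1 h2).hasFDerivAt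
    have e1 : HasDerivAt (fun s => ω s (X t))
        (fderiv ℝ (fun p : ℝ × ℝ => ω p.1 p.2) (t, X t) (1, 0)) t :=
      HasFDerivAt.comp_hasDerivAt (f := fun s : ℝ => (s, X t)) t hD
        ((hasDerivAt_id t).prodMk (hasDerivAt_const t (X t)))
    have e2 : HasDerivAt (fun y => ω t y)
        (fderiv ℝ (fun p : ℝ × ℝ => ω p.1 p.2) (t, X t) (0, 1)) (X t) :=
      HasFDerivAt.comp_hasDerivAt (f := fun y : ℝ => (t, y)) (X t) hD
        ((hasDerivAt_const (X t) t).prodMk (hasDerivAt_id (X t)))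
    have e3 : HasDerivWithinAt (fun t => ω t (X t))
        (fderiv ℝ (fun p : ℝ × ℝ => ω p.1 p.2) (t, X t) (1, V t (X t))) (Icc s T) t :=
      HasFDerivAt.comp_hasDerivWithinAt (f := fun t : ℝ => (t, X t)) t hD
        ((hasDerivWithinAt_id t (Icc s T)).prodMk (hX' t ht))
    have h0 := hω t (X t) ht0 h1 h2
    rw [e1.deriv, e2.deriv, ← smul_eq_mul, ← map_smul, ← map_add] at h0
    have hv : ((1 : ℝ), (0 : ℝ)) + V t (X t) • ((0 : ℝ), (1 : ℝ)) = (1, V t (X t)) := by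
      simp
    rw [hv] at h0
    rwa [h0] at e3
  have hc : ContinuousOn (fun t => ω t (X t)) (Icc s T) :=
    fun t ht => (key t ht).continuousWithinAt
  refine constant_of_derivWithin_zero (fun t ht => (key t ht).differentiableWithinAt) ?_ T
    ⟨hsT, le_refl T⟩
  intro t ht
  exact (key t ⟨ht.1, ht.2.le⟩).derivWithin
    (uniqueDiffOn_Icc (lt_of_le_of_lt ht.1 ht.2) t ⟨ht.1, ht.2.le⟩)

/-- `(ρ, ω)` solves the nonlocal system `∂ₜρ + ∂ₓ(ρ V) = 0`, `∂ₜω + V ∂ₓω = 0` on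
`{t > 0, a < x < β(t)}`, `β(t) = b + t v̄`, with initial data `(ρ₀, ω₀)` on `[a, b]`, zero inflow
at `a`, and the leader condition on the zone `[β(t), β(t) + η]` in front of the domain. Only the
values for `a ≤ x ≤ β(t) + η` enter. -/
structure IsSolution (a b η vbar : ℝ) (W : ℝ → ℝ) (v : ℝ → ℝ → ℝ) (ρmax : ℝ → ℝ)
    (ρ₀ ω₀ : ℝ → ℝ) (ρ ω : ℝ → ℝ → ℝ) : Prop where
  /-- the values lie in the domain of the velocity function -/
  mem_domain : ∀ t x, 0 ≤ t → a ≤ x → x ≤ leader b vbar t →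
    0 < ω t x ∧ 0 ≤ ρ t x ∧ ρ t x ≤ ρmax (ω t x)
  marker_continuous : ContinuousOn (fun p : ℝ × ℝ => ω p.1 p.2)
    {p : ℝ × ℝ | 0 ≤ p.1 ∧ a ≤ p.2 ∧ p.2 ≤ leader b vbar p.1}
  density_eq : ∀ t x, 0 < t → a < x → x < leader b vbar t →
    HasDerivAt (fun y => ρ t y * nonlocalVelocity η W v ρ ω t y)
      (-(deriv (fun s => ρ s x) t)) x
  marker_eq : IsTransported a (leader b vbar) (nonlocalVelocity η W v ρ ω) ω
  density_initial : ∀ x ∈ Icc a b, ρ 0 x = ρ₀ x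
  marker_initial : ∀ x ∈ Icc a b, ω 0 x = ω₀ x
  density_left : ∀ t, 0 < t → ρ t a = 0
  marker_left : ∀ t, 0 < t → ω t a = ω₀ a
  density_right : ∀ t y, 0 ≤ t → leader b vbar t ≤ y → y ≤ leader b vbar t + η →
    ρ t y = eqDensity v ρmax vbar (ω₀ b)
  marker_right : ∀ t y, 0 ≤ t → leader b vbar t ≤ y → y ≤ leader b vbar t + η →
    ω t y = ω₀ b

/-- `c_ρ = inf_{t ≥ 0} ∫_{β(t)-η}^{β(t)} ρ(t, x) dx`. -/
def minMass (b η vbar : ℝ) (ρ : ℝ → ℝ → ℝ) : ℝ :=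
  sInf ((fun t => ∫ x in (leader b vbar t - η)..(leader b vbar t), ρ t x) '' Ici 0)

/-- `α(t) = sup {x ∈ [β(t)-η, β(t)] : ∫_x^{β(t)} ρ(t, y) dy ≥ c_ρ}`. -/
def leftBoundary (b η vbar : ℝ) (ρ : ℝ → ℝ → ℝ) (t : ℝ) : ℝ :=
  sSup {x | leader b vbar t - η ≤ x ∧ x ≤ leader b vbar t ∧
    minMass b η vbar ρ ≤ ∫ y in x..(leader b vbar t), ρ t y}

/-- The Lyapunov function `L(t) = ∫_{α(t)}^{β(t)} (ρ(t, x) - ρ̄(t, x))² dx`, where `ρ̄(t, x)` is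
the equilibrium density of the marker `ω(t, x)`. -/
def lyapunov (b η vbar : ℝ) (v : ℝ → ℝ → ℝ) (ρmax : ℝ → ℝ) (ρ ω : ℝ → ℝ → ℝ) (t : ℝ) : ℝ :=
  ∫ x in (leftBoundary b η vbar ρ t)..(leader b vbar t),
    (ρ t x - eqDensity v ρmax vbar (ω t x)) ^ 2

/-- `ρ_min = inf_{x ∈ [α(0), b]} min {ρ(0, x), ρ̄(0, x)}`. -/
def rhoMin (b η vbar : ℝ) (v : ℝ → ℝ → ℝ) (ρmax : ℝ → ℝ) (ρ ω : ℝ → ℝ → ℝ) : ℝ :=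
  sInf ((fun x => min (ρ 0 x) (eqDensity v ρmax vbar (ω 0 x))) ''
    Icc (leftBoundary b η vbar ρ 0) b)

end NonlocalGARZ

end

/-! Everything happens in Lagrangian coordinates. In front of the leader the local speed is the
constant `v̄`, and a continuous local speed averaged against a C¹ kernel is C¹ in space. Hence `V`
has a flow `X` with Jacobian `J = exp ∫ ∂ₓV`. Along it `ω` is constant, `ρ J = ρ₀`, and the mass
between a trajectory and the leader is conserved. The point `α(t)` is cut out by a fixed mass, so it
is itself a trajectory (`flow_left`), as is `β(t)` (`flow_right`). With `R = ρ₀ / J` and `r =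
ρ̄(ω₀(ξ))`, which does not depend on time, `L(t)` becomes the integral of `(R - r)² J` over the
fixed interval `(α(0), b)` (`lyapunov_eq`).

Since `R' = -∂ₓV R`, the integrand has time derivative `-∂ₓV (R - r)(R + r) J`. The theorem
therefore reduces to the pointwise bound `∂ₓV (R - r) ≥ -v'max W(β - α) (R - r)²`. This bound makes
`(R - r)²` nonincreasing, so `R` stays between `R₀` and `r` and `R + r ≥ 2 ρ_min`. A Gronwall
argument for each `ξ` (`sq_mul_jacobian_le`) is then integrated over `ξ` (`lyapunov_le`).

The pointwise bound starts from `∂ₓV(x) = W(0)(v̄ - v(x)) + ∫ W'(z)(v̄ - v(x + z)) dz`, where `v(x)`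
is the local speed at `x`. For a constant kernel the integral vanishes, and the decrease of `v` in
`ρ` suffices (`velocity_gradient_of_const`). Otherwise monotonicity of the density behind the leader
is preserved by a maximum principle (`density_flow_monotone`), so `v̄ - v` keeps one sign and is
largest in size at `x` among the points ahead. As `W' ≤ 0` and the integrand vanishes beyond the
leader, the integral cannot lower the factor `W(0)` below `W(β - x) ≥ W(β - α)`
(`velocity_gradient_of_monotone`).

The `H²` regularity enters through `IsC1H2.exists_timeDeriv` and the continuity of each `ρ t`. -/

noncomputable section
namespace NonlocalGARZ
open Filter Topology

/-! ### Point values and time derivatives of `H²`-valued curves. -/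

section

/-- A sequence of smooth bump functions at the origin whose supports shrink to a point. -/
def shrinkingBump (n : ℕ) : ContDiffBump (0 : ℝ) where
  rIn := 1 / (n + 2) / 2
  rOut := 1 / (n + 2)
  rIn_pos := by positivity
  rIn_lt_rOut := half_lt_self (by positivity)

theorem tendsto_rOut_shrinkingBump :
    Tendsto (fun n => (shrinkingBump n).rOut) atTop (𝓝 0) := by
  have h := (tendsto_const_div_atTop_nhds_zero_nat (1 : ℝ)).comp (tendsto_add_atTop_nat 2)
  refine h.congr fun n => ?_
  simp [shrinkingBump]

/-- The primitive of the normalized bump function, a smooth approximation of the unit step. -/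
def smoothStep (n : ℕ) (z : ℝ) : ℝ := ∫ s in (-2 : ℝ)..z, (shrinkingBump n).normed volume s

theorem rOut_shrinkingBump_lt_one (n : ℕ) : (shrinkingBump n).rOut < 1 := by
  simp only [shrinkingBump]
  rw [div_lt_one (by positivity)]
  have : (0 : ℝ) ≤ n := n.cast_nonneg
  linarith

theorem normed_shrinkingBump_eq_zero {n : ℕ} {s : ℝ} (hs : (shrinkingBump n).rOut ≤ |s|) :
    (shrinkingBump n).normed volume s = 0 := by
  rw [← Function.notMem_support, ContDiffBump.support_normed_eq]
  simpa [Metric.mem_ball, Real.dist_eq] using hs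

theorem hasDerivAt_smoothStep (n : ℕ) (z : ℝ) :
    HasDerivAt (smoothStep n) ((shrinkingBump n).normed volume z) z :=
  intervalIntegral.integral_hasDerivAt_right
    ((shrinkingBump n).continuous_normed.intervalIntegrable _ _)
    ((shrinkingBump n).continuous_normed.stronglyMeasurableAtFilter _ _)
    (shrinkingBump n).continuous_normed.continuousAt

theorem contDiff_smoothStep (n : ℕ) : ContDiff ℝ (⊤ : ℕ∞) (smoothStep n) := by
  rw [contDiff_infty_iff_deriv]
  refine ⟨fun z => (hasDerivAt_smoothStep n z).differentiableAt, ?_⟩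
  rw [funext fun z => (hasDerivAt_smoothStep n z).deriv]
  exact (shrinkingBump n).contDiff_normed

theorem smoothStep_of_le {n : ℕ} {z : ℝ} (hz : z ≤ -(shrinkingBump n).rOut) :
    smoothStep n z = 0 := by
  have h1 := rOut_shrinkingBump_lt_one n
  have h0 := (shrinkingBump n).rOut_pos
  rw [smoothStep, intervalIntegral.integral_zero_ae]
  refine Eventually.of_forall fun s hs => normed_shrinkingBump_eq_zero ?_
  have : s ≤ -(shrinkingBump n).rOut := by
    rcases le_total (-2) z with h | h
    · rw [uIoc_of_le h] at hs; linarith [hs.2]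
    · rw [uIoc_of_ge h] at hs; linarith [hs.2]
  rw [abs_of_nonpos (by linarith)]
  linarith

theorem smoothStep_of_ge {n : ℕ} {z : ℝ} (hz : (shrinkingBump n).rOut ≤ z) :
    smoothStep n z = 1 := by
  have h1 := rOut_shrinkingBump_lt_one n
  have h0 := (shrinkingBump n).rOut_pos
  rw [smoothStep, intervalIntegral.integral_eq_integral_of_support_subset,
    (shrinkingBump n).integral_normed]
  rw [ContDiffBump.support_normed_eq]
  intro s hs
  rw [Metric.mem_ball, Real.dist_eq, sub_zero, abs_lt] at hs
  exact ⟨by linarith [hs.1], by linarith [hs.2]⟩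

theorem smoothStep_monotone (n : ℕ) : Monotone (smoothStep n) :=
  monotone_of_deriv_nonneg (fun z => (hasDerivAt_smoothStep n z).differentiableAt) fun z => by
    rw [(hasDerivAt_smoothStep n z).deriv]
    exact (shrinkingBump n).nonneg_normed z

theorem smoothStep_mem_Icc (n : ℕ) (z : ℝ) : smoothStep n z ∈ Icc (0 : ℝ) 1 := by
  constructor
  · rw [← smoothStep_of_le (min_le_right z (-(shrinkingBump n).rOut))]
    exact smoothStep_monotone n (min_le_left _ _)
  · rw [← smoothStep_of_ge (le_max_right z (shrinkingBump n).rOut)]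
    exact smoothStep_monotone n (le_max_left _ _)

theorem tendsto_integral_mul_normed {f : ℝ → ℝ} (hf : Continuous f) (x : ℝ) :
    Tendsto (fun n => ∫ z, f z * (shrinkingBump n).normed volume (z - x)) atTop (𝓝 (f x)) := by
  have h := ContDiffBump.convolution_tendsto_right_of_continuous (μ := volume)
    tendsto_rOut_shrinkingBump hf x
  refine h.congr fun n => ?_
  rw [MeasureTheory.convolution_eq_swap]
  refine integral_congr_ae (Eventually.of_forall fun z => ?_)
  simp only [ContinuousLinearMap.lsmul_apply, smul_eq_mul]
  rw [mul_comm, ← ContDiffBump.normed_neg, neg_sub]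

theorem L2.intervalIntegrable (f : L2) (x y : ℝ) : IntervalIntegrable f volume x y :=
  (((Lp.memLp f).locallyIntegrable (by norm_num)).integrableOn_isCompact
    isCompact_uIcc).intervalIntegrable

/-- The weak derivative is tested with smoothed indicators of `(x, y]`. Their derivatives are
approximate Dirac masses at `x` and `y`, which recover the point values of the continuous
representative, and the other side converges by dominated convergence. -/
theorem IsWeakDeriv.sub_eq_integral_of_lt {f g : L2} (h : IsWeakDeriv f g) {f₀ : ℝ → ℝ}
    (hc : Continuous f₀) (hf : f₀ =ᵐ[volume] f) {x y : ℝ} (hxy : x < y) :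
    f₀ y - f₀ x = ∫ s in x..y, g s := by
  set φ : ℕ → ℝ → ℝ := fun n z => smoothStep n (z - x) - smoothStep n (z - y) with hφ
  have hφd : ∀ n z, HasDerivAt (φ n) ((shrinkingBump n).normed volume (z - x) -
      (shrinkingBump n).normed volume (z - y)) z := fun n z =>
    ((hasDerivAt_smoothStep n (z - x)).comp_sub_const z x).sub
      ((hasDerivAt_smoothStep n (z - y)).comp_sub_const z y)
  have hφc : ∀ n, ContDiff ℝ (⊤ : ℕ∞) (φ n) := fun n =>
    ((contDiff_smoothStep n).comp (contDiff_id.sub contDiff_const)).sub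
      ((contDiff_smoothStep n).comp (contDiff_id.sub contDiff_const))
  have hφz : ∀ n z, z ∉ Icc (x - 1) (y + 1) → φ n z = 0 := by
    intro n z hz
    have h1 := rOut_shrinkingBump_lt_one n
    rw [mem_Icc, not_and_or, not_le, not_le] at hz
    rcases hz with hz | hz
    · simp only [hφ]
      rw [smoothStep_of_le (by linarith), smoothStep_of_le (by linarith), sub_zero]
    · simp only [hφ]
      rw [smoothStep_of_ge (by linarith), smoothStep_of_ge (by linarith), sub_self]
  have hφs : ∀ n, HasCompactSupport (φ n) := fun n =>
    HasCompactSupport.intro isCompact_Icc (hφz n)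
  have hφb : ∀ n z, ‖φ n z‖ ≤ 1 := by
    intro n z
    have h1 := smoothStep_mem_Icc n (z - x)
    have h2 := smoothStep_mem_Icc n (z - y)
    rw [Real.norm_eq_abs, abs_le]
    constructor <;> simp only [hφ] <;> linarith [h1.1, h1.2, h2.1, h2.2]
  have e1 : Tendsto (fun n => ∫ z, f z * deriv (φ n) z) atTop (𝓝 (f₀ x - f₀ y)) := by
    refine ((tendsto_integral_mul_normed hc x).sub (tendsto_integral_mul_normed hc y)).congr
      fun n => ?_
    have hi : ∀ c : ℝ, Integrable fun z => f₀ z * (shrinkingBump n).normed volume (z - c) := by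
      intro c
      refine Continuous.integrable_of_hasCompactSupport
        (hc.mul ((shrinkingBump n).continuous_normed.comp (continuous_id.sub continuous_const))) ?_
      exact ((shrinkingBump n).hasCompactSupport_normed.comp_homeomorph
        (Homeomorph.subRight c)).mul_left
    rw [← integral_sub (hi x) (hi y)]
    refine integral_congr_ae ?_
    filter_upwards [hf] with z hz
    rw [(hφd n z).deriv, hz, mul_sub]
  have e2 : Tendsto (fun n => ∫ z, g z * φ n z) atTop (𝓝 (∫ z, (Ioc x y).indicator g z)) := by
    refine tendsto_integral_of_dominated_convergence
      (fun z => (Icc (x - 1) (y + 1)).indicator (fun z => ‖g z‖) z) ?_ ?_ ?_ ?_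
    · exact fun n => (integrable_mul_test g (hφc n).continuous (hφs n)).aestronglyMeasurable
    · rw [integrable_indicator_iff measurableSet_Icc]
      exact (((Lp.memLp g).locallyIntegrable (by norm_num)).integrableOn_isCompact
        isCompact_Icc).norm
    · refine fun n => Eventually.of_forall fun z => ?_
      by_cases hz : z ∈ Icc (x - 1) (y + 1)
      · rw [indicator_of_mem hz, norm_mul]
        exact mul_le_of_le_one_right (norm_nonneg _) (hφb n z)
      · rw [indicator_of_notMem hz, hφz n z hz, mul_zero, norm_zero]
    -- Away from the two jump points the test functions eventually equal the indicator exactly.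
    · have hx : ∀ᵐ z ∂(volume : Measure ℝ), z ≠ x := Measure.ae_ne volume x
      have hy : ∀ᵐ z ∂(volume : Measure ℝ), z ≠ y := Measure.ae_ne volume y
      filter_upwards [hx, hy] with z hzx hzy
      have hsmall : ∀ᶠ n in atTop, (shrinkingBump n).rOut < min |z - x| |z - y| :=
        tendsto_rOut_shrinkingBump.eventually_lt_const
          (lt_min (abs_pos.2 (sub_ne_zero.2 hzx)) (abs_pos.2 (sub_ne_zero.2 hzy)))
      refine tendsto_const_nhds.congr' ?_
      filter_upwards [hsmall] with n hn
      have hn1 := hn.trans_le (min_le_left _ _)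
      have hn2 := hn.trans_le (min_le_right _ _)
      simp only [hφ]
      rcases lt_or_gt_of_ne hzx with h1 | h1
      · rw [abs_of_neg (by linarith)] at hn1 hn2
        rw [smoothStep_of_le (by linarith), smoothStep_of_le (by linarith),
          indicator_of_notMem (fun h => by linarith [h.1])]
        simp
      · rw [abs_of_pos (by linarith)] at hn1
        rw [smoothStep_of_ge hn1.le]
        rcases lt_or_gt_of_ne hzy with h2 | h2
        · rw [abs_of_neg (by linarith)] at hn2
          rw [smoothStep_of_le (by linarith), indicator_of_mem (show z ∈ Ioc x y from ⟨h1, h2.le⟩)]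
          simp
        · rw [abs_of_pos (by linarith)] at hn2
          rw [smoothStep_of_ge hn2.le, indicator_of_notMem (fun h => by linarith [h.2])]
          simp
  have e3 : Tendsto (fun n => ∫ z, f z * deriv (φ n) z) atTop
      (𝓝 (-∫ z, (Ioc x y).indicator g z)) :=
    e2.neg.congr fun n => (h (φ n) (hφc n) (hφs n)).symm
  have := tendsto_nhds_unique e1 e3
  rw [intervalIntegral.integral_of_le hxy.le, ← integral_indicator measurableSet_Ioc]
  linarith

/-- The weight whose `L²` pairing with `f'` gives the mean increment of `f` over `[x, x + 1]`. -/
theorem memLp_rampWeight (x : ℝ) :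
    MemLp ((Ioc x (x + 1)).indicator fun s => x + 1 - s) 2 (volume : Measure ℝ) := by
  refine (memLp_indicator_iff_restrict measurableSet_Ioc).2 (MemLp.of_bound
    (continuous_const.sub continuous_id).aestronglyMeasurable 1 ?_)
  refine (ae_restrict_iff' measurableSet_Ioc).2 (Eventually.of_forall fun s hs => ?_)
  rw [Real.norm_eq_abs, abs_le]
  constructor <;> linarith [hs.1, hs.2]

/-- Point evaluation at `x` on the triples `(f, f', f'')`. -/
def evalAt (x : ℝ) : (L2 × L2 × L2) →L[ℝ] ℝ :=
  (innerSL ℝ (indicatorConstLp 2 (measurableSet_Ioc (a := x) (b := x + 1))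
      (by simp) (1 : ℝ) : L2)).comp (ContinuousLinearMap.fst ℝ L2 (L2 × L2)) -
    (innerSL ℝ ((memLp_rampWeight x).toLp _ : L2)).comp
      ((ContinuousLinearMap.fst ℝ L2 L2).comp (ContinuousLinearMap.snd ℝ L2 (L2 × L2)))

/-- The mean of `f` over `[x, x + 1]` minus the mean increment of `f` there: both are `L²` pairings,
and for a weakly differentiable `f` their difference is `f(x)`. -/
theorem evalAt_apply (x : ℝ) (u : L2 × L2 × L2) :
    evalAt x u = (∫ s in x..(x + 1), u.1 s) - ∫ s in x..(x + 1), (x + 1 - s) * u.2.1 s := by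
  have h1 : (x : ℝ) ≤ x + 1 := by linarith
  simp only [evalAt, sub_apply, ContinuousLinearMap.comp_apply,
    ContinuousLinearMap.coe_fst', ContinuousLinearMap.coe_snd', innerSL_apply_apply]
  rw [L2.inner_indicatorConstLp_one, L2.inner_def, intervalIntegral.integral_of_le h1,
    intervalIntegral.integral_of_le h1]
  congr 1
  rw [← integral_indicator measurableSet_Ioc]
  refine integral_congr_ae ?_
  filter_upwards [(memLp_rampWeight x).coeFn_toLp] with s hs
  rw [hs]
  by_cases hm : s ∈ Ioc x (x + 1)
  · simp [indicator_of_mem hm, mul_comm]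
  · simp [indicator_of_notMem hm]

/-- Both weights have `L²` norm at most one. That the bound is uniform in `x` is what gives joint
continuity of evaluation. -/
theorem norm_evalAt_apply_le (x : ℝ) (u : L2 × L2 × L2) : ‖evalAt x u‖ ≤ 2 * ‖u‖ := by
  have hI : ‖(indicatorConstLp 2 (measurableSet_Ioc (a := x) (b := x + 1))
      (by simp) (1 : ℝ) : L2)‖ = 1 := by
    rw [norm_indicatorConstLp (by norm_num) (by norm_num)]
    simp
  have hR : ‖((memLp_rampWeight x).toLp _ : L2)‖ ≤ 1 := by
    refine le_trans ?_ hI.le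
    refine Lp.norm_le_norm_of_ae_le ?_
    filter_upwards [(memLp_rampWeight x).coeFn_toLp,
      indicatorConstLp_coeFn (p := 2) (μ := volume) (c := (1 : ℝ))
        (hs := measurableSet_Ioc (a := x) (b := x + 1)) (hμs := by simp)] with s h1 h2
    rw [h1, h2]
    by_cases hm : s ∈ Ioc x (x + 1)
    · rw [indicator_of_mem hm, indicator_of_mem hm, Real.norm_eq_abs, abs_of_nonneg, norm_one] <;>
        linarith [hm.1, hm.2]
    · simp [indicator_of_notMem hm]
  simp only [evalAt, sub_apply, ContinuousLinearMap.comp_apply,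
    ContinuousLinearMap.coe_fst', ContinuousLinearMap.coe_snd', innerSL_apply_apply]
  have e1 := norm_inner_le_norm (𝕜 := ℝ) (indicatorConstLp 2
    (measurableSet_Ioc (a := x) (b := x + 1)) (by simp) (1 : ℝ) : L2) u.1
  have e2 := norm_inner_le_norm (𝕜 := ℝ) ((memLp_rampWeight x).toLp _ : L2) u.2.1
  rw [hI] at e1
  have n1 : ‖u.1‖ ≤ ‖u‖ := norm_fst_le u
  have n2 : ‖u.2.1‖ ≤ ‖u‖ := (norm_fst_le u.2).trans (norm_snd_le u)
  have e3 : ‖((memLp_rampWeight x).toLp _ : L2)‖ * ‖u.2.1‖ ≤ 1 * ‖u.2.1‖ :=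
    mul_le_mul_of_nonneg_right hR (norm_nonneg _)
  refine (norm_sub_le _ _).trans ?_
  linarith

theorem continuous_evalAt_apply (u : L2 × L2 × L2) : Continuous fun x => evalAt x u := by
  have hp : ∀ f : ℝ → ℝ, (∀ x y, IntervalIntegrable f volume x y) →
      Continuous fun x => ∫ s in x..(x + 1), f s := by
    intro f hf
    have h0 : Continuous fun x => ∫ s in (0 : ℝ)..x, f s :=
      intervalIntegral.continuous_primitive hf 0
    have : (fun x => ∫ s in x..(x + 1), f s) =
        fun x => (∫ s in (0 : ℝ)..(x + 1), f s) - ∫ s in (0 : ℝ)..x, f s := by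
      funext x
      rw [intervalIntegral.integral_interval_sub_left (hf _ _) (hf _ _)]
    rw [this]
    exact (h0.comp (continuous_id.add continuous_const)).sub h0
  have hi : ∀ x y, IntervalIntegrable (fun s => s * u.2.1 s) volume x y := fun x y =>
    (L2.intervalIntegrable u.2.1 x y).continuousOn_mul continuous_id.continuousOn
  have : (fun x => evalAt x u) = fun x => (∫ s in x..(x + 1), u.1 s) -
      ((x + 1) * (∫ s in x..(x + 1), u.2.1 s) - ∫ s in x..(x + 1), s * u.2.1 s) := by
    funext x
    rw [evalAt_apply, ← intervalIntegral.integral_const_mul, ← intervalIntegral.integral_sub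
      ((L2.intervalIntegrable u.2.1 _ _).const_mul _) (hi _ _)]
    simp_rw [sub_mul]
  rw [this]
  exact (hp _ (L2.intervalIntegrable _)).sub (((continuous_id.add continuous_const).mul
    (hp _ (L2.intervalIntegrable _))).sub (hp _ hi))

theorem continuous_evalAt : Continuous fun p : (L2 × L2 × L2) × ℝ => evalAt p.2 p.1 := by
  rw [continuous_iff_continuousAt]
  rintro ⟨u₀, x₀⟩
  rw [ContinuousAt, tendsto_iff_norm_sub_tendsto_zero]
  have h : Tendsto (fun p : (L2 × L2 × L2) × ℝ =>
      2 * ‖p.1 - u₀‖ + ‖evalAt p.2 u₀ - evalAt x₀ u₀‖) (𝓝 (u₀, x₀)) (𝓝 0) := by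
    have hc : Continuous fun p : (L2 × L2 × L2) × ℝ =>
      2 * ‖p.1 - u₀‖ + ‖evalAt p.2 u₀ - evalAt x₀ u₀‖ :=
      (continuous_const.mul (continuous_fst.sub continuous_const).norm).add
        (((continuous_evalAt_apply u₀).comp continuous_snd).sub continuous_const).norm
    simpa using hc.tendsto (u₀, x₀)
  refine squeeze_zero (fun _ => norm_nonneg _) (fun p => ?_) h
  have : evalAt p.2 p.1 - evalAt x₀ u₀ =
      evalAt p.2 (p.1 - u₀) + (evalAt p.2 u₀ - evalAt x₀ u₀) := by
    rw [map_sub]; ring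
  rw [this]
  exact (norm_add_le _ _).trans (by gcongr; exact norm_evalAt_apply_le _ _)

/-- Integration by parts against `z - y`; since `g` is only integrable, its primitive is handled as
an absolutely continuous function. -/
theorem integral_primitive_eq {g : ℝ → ℝ} {x y : ℝ} (hg : IntervalIntegrable g volume x y) :
    ∫ z in x..y, ∫ s in x..z, g s = ∫ s in x..y, (y - s) * g s := by
  have hG := hg.absolutelyContinuousOnInterval_intervalIntegral (c := x) left_mem_uIcc
  have hP : AbsolutelyContinuousOnInterval (fun z => z - y) x y :=
    (contDiff_id.sub contDiff_const).contDiffOn.absolutelyContinuousOnInterval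
  have h := hG.integral_mul_deriv_eq_deriv_mul hP
  simp only [sub_self, mul_zero, intervalIntegral.integral_same, zero_mul, zero_sub] at h
  have hd : ∀ z : ℝ, deriv (fun z => z - y) z = 1 := fun z => by simp
  simp only [hd, mul_one] at h
  rw [h, ← intervalIntegral.integral_neg]
  refine intervalIntegral.integral_congr_ae ?_
  filter_upwards [hg.ae_hasDerivAt_integral] with z hz hzm
  rw [(hz (uIoc_subset_uIcc hzm) x left_mem_uIcc).deriv]
  ring

theorem IsWeakDeriv.eq_evalAt {u : L2 × L2 × L2} (h : IsWeakDeriv u.1 u.2.1) {f₀ : ℝ → ℝ}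
    (hc : Continuous f₀) (hf : f₀ =ᵐ[volume] u.1) (x : ℝ) : f₀ x = evalAt x u := by
  have h1 : (x : ℝ) ≤ x + 1 := by linarith
  rw [evalAt_apply, ← integral_primitive_eq (L2.intervalIntegrable _ _ _),
    ← intervalIntegral.integral_congr_ae (hf.mono fun z hz _ => hz)]
  have h2 : ∫ z in x..(x + 1), ∫ s in x..z, u.2.1 s = ∫ z in x..(x + 1), (f₀ z - f₀ x) := by
    refine intervalIntegral.integral_congr fun z hz => ?_
    rw [uIcc_of_le h1] at hz
    rcases hz.1.eq_or_lt with rfl | hlt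
    · simp
    · exact (h.sub_eq_integral_of_lt hc hf hlt).symm
  rw [h2, intervalIntegral.integral_sub (hc.intervalIntegrable _ _) (by simp)]
  simp

/-- A fixed continuous linear functional commutes with the time derivative of the curve, and joint
continuity of evaluation transfers to both `u` and its derivative. -/
theorem exists_timeDeriv_of_eval {E : Type*} [NormedAddCommGroup E] [NormedSpace ℝ E]
    (ev : ℝ → E →L[ℝ] ℝ) (hev : Continuous fun p : E × ℝ => ev p.2 p.1) {u : ℝ → E}
    (hu : ContDiffOn ℝ 1 u (Ici 0)) {ρ : ℝ → ℝ → ℝ} (hρ : ∀ t x, 0 ≤ t → ρ t x = ev x (u t)) :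
    ContinuousOn (fun p : ℝ × ℝ => ρ p.1 p.2) (Ici 0 ×ˢ univ) ∧
    ∃ ρt : ℝ → ℝ → ℝ, ContinuousOn (fun p : ℝ × ℝ => ρt p.1 p.2) (Ici 0 ×ˢ univ) ∧
      ∀ t x, 0 < t → HasDerivAt (fun s => ρ s x) (ρt t x) t := by
  have hjoint : ∀ w : ℝ → E, ContinuousOn w (Ici 0) →
      ContinuousOn (fun p : ℝ × ℝ => ev p.2 (w p.1)) (Ici 0 ×ˢ univ) := by
    intro w hw
    have h1 : ContinuousOn (fun p : ℝ × ℝ => (w p.1, p.2)) (Ici 0 ×ˢ univ) :=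
      (hw.comp continuousOn_fst fun p hp => hp.1).prodMk continuousOn_snd
    exact hev.comp_continuousOn h1
  refine ⟨(hjoint u hu.continuousOn).congr fun p hp => hρ p.1 p.2 hp.1,
    fun t x => ev x (derivWithin u (Ici 0) t),
    hjoint _ (hu.continuousOn_derivWithin (uniqueDiffOn_Ici 0) le_rfl), ?_⟩
  intro t x ht
  have hd : HasDerivAt u (derivWithin u (Ici 0) t) t :=
    ((hu.differentiableOn one_ne_zero t ht.le).hasDerivWithinAt).hasDerivAt (Ici_mem_nhds ht)
  refine ((ev x).hasFDerivAt.comp_hasDerivAt t hd).congr_of_eventuallyEq ?_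
  filter_upwards [Ici_mem_nhds ht] with s hs
  exact hρ s x hs

theorem isWeakDeriv_H2 (u : H2) :
    IsWeakDeriv (u : L2 × L2 × L2).1 (u : L2 × L2 × L2).2.1 :=
  (show IsWeakDeriv _ _ ∧ IsWeakDeriv _ _ from u.property).1

/-- Point evaluation on `H²(ℝ)`. -/
def H2eval (x : ℝ) : H2 →L[ℝ] ℝ := (evalAt x).comp H2.subtypeL

theorem continuous_H2eval : Continuous fun p : H2 × ℝ => H2eval p.2 p.1 := by
  have h1 : Continuous fun p : H2 × ℝ => ((p.1 : L2 × L2 × L2), p.2) := by fun_prop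
  have h2 := continuous_evalAt.comp h1
  exact h2

/-- A density of class `C¹([0,∞); H²(ℝ))` is jointly continuous and has a jointly continuous
pointwise time derivative. -/
theorem IsC1H2.exists_timeDeriv {ρ : ℝ → ℝ → ℝ} (h : IsC1H2 ρ) :
    ContinuousOn (fun p : ℝ × ℝ => ρ p.1 p.2) (Ici 0 ×ˢ univ) ∧
    ∃ ρt : ℝ → ℝ → ℝ, ContinuousOn (fun p : ℝ × ℝ => ρt p.1 p.2) (Ici 0 ×ˢ univ) ∧
      ∀ t x, 0 < t → HasDerivAt (fun s => ρ s x) (ρt t x) t := by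
  have h2 := h.2
  obtain ⟨u, hu⟩ := h2
  exact exists_timeDeriv_of_eval (E := H2) H2eval continuous_H2eval hu.1
    fun t x ht => (isWeakDeriv_H2 (u t)).eq_evalAt (h.1 t ht) (hu.2 t ht) x

end

/-! ### Flows of C¹ vector fields and their Jacobians. -/

section

theorem hasDerivAt_primitive {f : ℝ → ℝ} (hf : Continuous f) (a x : ℝ) :
    HasDerivAt (fun y => ∫ s in a..y, f s) (f x) x :=
  intervalIntegral.integral_hasDerivAt_right (hf.intervalIntegrable _ _)
    (hf.stronglyMeasurableAtFilter _ _) hf.continuousAt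

/-- Hadamard's form of the difference: the quotient is an integral that depends continuously on
parameters, also at `y = x`. It serves the flow, uniqueness of trajectories, and integrals with
moving endpoints. -/
theorem sub_eq_mul_integral_segment {f f' : ℝ → ℝ} (hf' : Continuous f')
    (hd : ∀ x, HasDerivAt f (f' x) x) (x y : ℝ) :
    f y - f x = (∫ θ in (0 : ℝ)..1, f' (x + θ * (y - x))) * (y - x) := by
  have h : ∀ θ ∈ uIcc (0 : ℝ) 1, HasDerivAt (fun θ => f (x + θ * (y - x)))
      (f' (x + θ * (y - x)) * (y - x)) θ := by
    intro θ _
    have h2 : HasDerivAt (fun θ : ℝ => x + θ * (y - x)) (y - x) θ := by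
      simpa using ((hasDerivAt_id θ).mul_const (y - x)).const_add x
    exact (hd _).comp θ h2
  have := intervalIntegral.integral_eq_sub_of_hasDerivAt h
    (Continuous.intervalIntegrable (by fun_prop) _ _)
  rw [intervalIntegral.integral_mul_const] at this
  rw [this]
  simp

/-- The solution of a linear scalar equation `D' = c D`. -/
theorem eq_mul_exp_of_linear {D c : ℝ → ℝ} {T : ℝ} (hc : Continuous c)
    (hD : ∀ t ∈ Icc 0 T, HasDerivWithinAt D (c t * D t) (Icc 0 T) t) {t : ℝ}
    (ht : t ∈ Icc 0 T) : D t = D 0 * Real.exp (∫ s in (0 : ℝ)..t, c s) := by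
  have key : ∀ s ∈ Icc 0 T, HasDerivWithinAt
      (fun s => D s * Real.exp (-∫ r in (0 : ℝ)..s, c r)) 0 (Icc 0 T) s := by
    intro s hs
    have h1 := ((hasDerivAt_primitive hc 0 s).neg.exp).hasDerivWithinAt (s := Icc 0 T)
    have h2 := (hD s hs).mul h1
    refine h2.congr_deriv ?_
    ring
  have h := constant_of_derivWithin_zero (fun s hs => (key s hs).differentiableWithinAt)
    (fun s hs => (key s ⟨hs.1, hs.2.le⟩).derivWithin
      (uniqueDiffOn_Icc (lt_of_le_of_lt hs.1 hs.2) s ⟨hs.1, hs.2.le⟩)) t ht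
  simp only [intervalIntegral.integral_same, neg_zero, Real.exp_zero, mul_one] at h
  rw [← h, mul_assoc, ← Real.exp_add, neg_add_cancel, Real.exp_zero, mul_one]

/-- The flow on `[0, T]` of a bounded vector field on the line whose space derivative is
continuous and bounded, and the derivative of the flow with respect to the initial point. -/
theorem exists_flow {V Vx : ℝ → ℝ → ℝ} (hV : Continuous fun p : ℝ × ℝ => V p.1 p.2)
    (hVx : Continuous fun p : ℝ × ℝ => Vx p.1 p.2) (hd : ∀ t x, HasDerivAt (V t) (Vx t x) x)
    {B K T : ℝ} (hB : ∀ t x, |V t x| ≤ B) (hK : ∀ t x, |Vx t x| ≤ K) (hT : 0 ≤ T) :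
    ∃ X : ℝ → ℝ → ℝ, (Continuous fun p : ℝ × ℝ => X p.1 p.2) ∧ (∀ ξ, X 0 ξ = ξ) ∧
      (∀ ξ, ∀ t ∈ Icc 0 T, HasDerivWithinAt (fun s => X s ξ) (V t (X t ξ)) (Icc 0 T) t) ∧
      ∀ t ∈ Icc 0 T, ∀ ξ,
        HasDerivAt (X t) (Real.exp (∫ s in (0 : ℝ)..t, Vx s (X s ξ))) ξ := by
  have hB0 : 0 ≤ B := (abs_nonneg _).trans (hB 0 0)
  have hK0 : 0 ≤ K := (abs_nonneg _).trans (hK 0 0)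
  have hlip : ∀ t, LipschitzWith K.toNNReal (V t) := fun t =>
    lipschitzWith_of_nnnorm_deriv_le (fun x => (hd t x).differentiableAt) fun x => by
      rw [(hd t x).deriv, ← NNReal.coe_le_coe, coe_nnnorm, Real.coe_toNNReal _ hK0]
      exact hK t x
  have hex : ∀ ξ : ℝ, ∃ y : ℝ → ℝ, y 0 = ξ ∧
      ∀ t ∈ Icc 0 T, HasDerivWithinAt y (V t (y t)) (Icc 0 T) t := by
    intro ξ
    -- A field bounded by `B` cannot leave the ball of radius `B * T` in time `T`, so one Picard
    -- step covers all of `[0, T]`.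
    have hP : IsPicardLindelof V (⟨0, left_mem_Icc.2 hT⟩ : Icc (0 : ℝ) T) ξ
        (B * T).toNNReal 0 B.toNNReal K.toNNReal :=
      { lipschitzOnWith := fun t _ => (hlip t).lipschitzOnWith
        continuousOn := fun x _ =>
          (hV.comp (continuous_id.prodMk continuous_const)).continuousOn
        norm_le := fun t _ x _ => by
          rw [Real.coe_toNNReal _ hB0]; exact hB t x
        mul_max_le := by
          rw [Real.coe_toNNReal _ hB0, Real.coe_toNNReal _ (mul_nonneg hB0 hT)]
          simp [hT] }
    exact hP.exists_eq_forall_mem_Icc_hasDerivWithinAt₀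
  choose Y hY0 hY using hex
  have hcl : ∀ t, max 0 (min t T) ∈ Icc 0 T := fun t =>
    ⟨le_max_left _ _, max_le hT (min_le_right _ _)⟩
  have hcl' : ∀ t ∈ Icc 0 T, max 0 (min t T) = t := fun t ht => by
    rw [min_eq_left ht.2, max_eq_right ht.1]
  have hYc : ContinuousOn (Function.uncurry Y) (univ ×ˢ Icc 0 T) := by
    refine continuousOn_prod_of_continuousOn_lipschitzOnWith _ (Real.exp (K * T)).toNNReal
      (fun ξ _ t ht => (hY ξ t ht).continuousWithinAt) fun t ht => ?_
    refine LipschitzOnWith.of_dist_le_mul fun ξ _ ξ' _ => ?_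
    have hr : ∀ ζ, ∀ s ∈ Ico 0 T, HasDerivWithinAt (Y ζ) (V s (Y ζ s)) (Ici s) s :=
      fun ζ s hs => ((hY ζ s ⟨hs.1, hs.2.le⟩).mono_of_mem_nhdsWithin
        (Icc_mem_nhdsGE_of_mem hs))
    have := dist_le_of_trajectories_ODE hlip (fun t ht => (hY ξ t ht).continuousWithinAt) (hr ξ)
      (fun t ht => (hY ξ' t ht).continuousWithinAt) (hr ξ') (δ := dist ξ ξ')
      (by rw [hY0, hY0]) t ht
    refine this.trans ?_
    rw [mul_comm, Real.coe_toNNReal _ (Real.exp_pos _).le, Real.coe_toNNReal _ hK0]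
    have : K * (t - 0) ≤ K * T := mul_le_mul_of_nonneg_left (by linarith [ht.2]) hK0
    gcongr
  -- Times outside `[0, T]` are clamped, so that continuity holds on the whole plane.
  set X : ℝ → ℝ → ℝ := fun t ξ => Y ξ (max 0 (min t T)) with hX
  have hXc : Continuous fun p : ℝ × ℝ => X p.1 p.2 := by
    have h1 : Continuous fun p : ℝ × ℝ => (p.2, max 0 (min p.1 T)) := by fun_prop
    exact hYc.comp_continuous h1 fun p => ⟨mem_univ _, hcl _⟩
  have hX0 : ∀ ξ, X 0 ξ = ξ := fun ξ => by simp [hX, hT, hY0]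
  have hXd : ∀ ξ, ∀ t ∈ Icc 0 T, HasDerivWithinAt (fun s => X s ξ) (V t (X t ξ)) (Icc 0 T) t := by
    intro ξ t ht
    have h := hY ξ t ht
    simp only [hX, hcl' t ht]
    exact h.congr (fun s hs => by rw [hcl' s hs]) (by rw [hcl' t ht])
  refine ⟨X, hXc, hX0, hXd, ?_⟩
  -- The difference of two trajectories solves `D' = c D`, with `c` the average of `Vx` over the
  -- segment joining them. The difference quotient of the flow is then exactly `exp ∫ c`, and its
  -- limit only needs continuity of `c`.
  set c : ℝ → ℝ → ℝ → ℝ := fun ξ ζ t =>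
    ∫ θ in (0 : ℝ)..1, Vx t (X t ξ + θ * (X t ζ - X t ξ)) with hc
  have hcc : Continuous fun q : (ℝ × ℝ) × ℝ => c q.1.1 q.1.2 q.2 := by
    refine intervalIntegral.continuous_parametric_intervalIntegral_of_continuous' ?_ 0 1
    have e1 : Continuous fun z : ((ℝ × ℝ) × ℝ) × ℝ => X z.1.2 z.1.1.1 :=
      hXc.comp (by fun_prop : Continuous fun z : ((ℝ × ℝ) × ℝ) × ℝ => (z.1.2, z.1.1.1))
    have e2 : Continuous fun z : ((ℝ × ℝ) × ℝ) × ℝ => X z.1.2 z.1.1.2 :=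
      hXc.comp (by fun_prop : Continuous fun z : ((ℝ × ℝ) × ℝ) × ℝ => (z.1.2, z.1.1.2))
    exact hVx.comp ((by fun_prop : Continuous fun z : ((ℝ × ℝ) × ℝ) × ℝ => z.1.2).prodMk
      (e1.add (continuous_snd.mul (e2.sub e1))))
  intro t ht ξ
  have hdiff : ∀ ζ, X t ζ - X t ξ = (ζ - ξ) * Real.exp (∫ s in (0 : ℝ)..t, c ξ ζ s) := by
    intro ζ
    have h := eq_mul_exp_of_linear (D := fun s => X s ζ - X s ξ) (c := c ξ ζ) (T := T)
      (hcc.comp (by fun_prop : Continuous fun s : ℝ => ((ξ, ζ), s))) (fun s hs => by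
        refine ((hXd ζ s hs).sub (hXd ξ s hs)).congr_deriv ?_
        exact sub_eq_mul_integral_segment
          (hVx.comp (by fun_prop : Continuous fun x : ℝ => (s, x))) (hd s) _ _) ht
    simpa only [hX0] using h
  have hE : Continuous fun ζ => Real.exp (∫ s in (0 : ℝ)..t, c ξ ζ s) := by
    refine Real.continuous_exp.comp
      (intervalIntegral.continuous_parametric_intervalIntegral_of_continuous' ?_ 0 t)
    exact hcc.comp (by fun_prop : Continuous fun z : ℝ × ℝ => ((ξ, z.1), z.2))
  have hlim : (∫ s in (0 : ℝ)..t, Vx s (X s ξ)) = ∫ s in (0 : ℝ)..t, c ξ ξ s := by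
    simp [hc]
  rw [hlim, hasDerivAt_iff_tendsto_slope]
  refine ((hE.tendsto ξ).mono_left nhdsWithin_le_nhds).congr' ?_
  filter_upwards [self_mem_nhdsWithin] with ζ hζ
  rw [slope_def_field, hdiff, mul_div_cancel_left₀ _ (sub_ne_zero.2 hζ)]

end

/-! ### Conservation of mass between characteristics. -/

section

theorem continuous_uncurry_left {f : ℝ → ℝ → ℝ} (hf : Continuous fun p : ℝ × ℝ => f p.1 p.2)
    (t : ℝ) : Continuous (f t) :=
  hf.comp (by fun_prop : Continuous fun x : ℝ => (t, x))

theorem continuous_uncurry_right {f : ℝ → ℝ → ℝ} (hf : Continuous fun p : ℝ × ℝ => f p.1 p.2)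
    (x : ℝ) : Continuous fun t => f t x :=
  hf.comp (by fun_prop : Continuous fun t : ℝ => (t, x))

theorem hasDerivAt_integral_of_continuous {r rt : ℝ → ℝ → ℝ}
    (hr : Continuous fun p : ℝ × ℝ => r p.1 p.2) (hrt : Continuous fun p : ℝ × ℝ => rt p.1 p.2)
    {t : ℝ} {S : Set ℝ} (hS : S ∈ 𝓝 t)
    (hd : ∀ s ∈ S, ∀ x, HasDerivAt (fun s => r s x) (rt s x) s) (x y : ℝ) :
    HasDerivAt (fun s => ∫ z in x..y, r s z) (∫ z in x..y, rt t z) t := by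
  obtain ⟨C, hC⟩ := (((isCompact_Icc (a := t - 1) (b := t + 1)).prod
    (isCompact_uIcc (a := x) (b := y))).bddAbove_image (f := fun p : ℝ × ℝ => ‖rt p.1 p.2‖)
      hrt.norm.continuousOn)
  refine (intervalIntegral.hasDerivAt_integral_of_dominated_loc_of_deriv_le
    (s := S ∩ Icc (t - 1) (t + 1)) (bound := fun _ => C) (F := r) (F' := rt)
    (inter_mem hS (Icc_mem_nhds (by linarith) (by linarith)))
    (Eventually.of_forall fun s => (continuous_uncurry_left hr s).aestronglyMeasurable)
    ((continuous_uncurry_left hr t).intervalIntegrable _ _)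
    (continuous_uncurry_left hrt t).aestronglyMeasurable
    (Eventually.of_forall fun z hz s hs => ?_) (by simp)
    (Eventually.of_forall fun z _ s hs => hd s hs.1 z)).2
  exact hC ⟨(s, z), ⟨hs.2, uIoc_subset_uIcc hz⟩, rfl⟩

/-- The Leibniz rule for an integral with a moving endpoint. -/
theorem hasDerivAt_integral_moving {r rt : ℝ → ℝ → ℝ}
    (hr : Continuous fun p : ℝ × ℝ => r p.1 p.2) (hrt : Continuous fun p : ℝ × ℝ => rt p.1 p.2)
    {t : ℝ} {S : Set ℝ} (hS : S ∈ 𝓝 t)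
    (hd : ∀ s ∈ S, ∀ x, HasDerivAt (fun s => r s x) (rt s x) s)
    {A : ℝ → ℝ} {A' : ℝ} (hA : HasDerivAt A A' t) :
    HasDerivAt (fun s => ∫ z in (0 : ℝ)..(A s), r s z)
      (r t (A t) * A' + ∫ z in (0 : ℝ)..(A t), rt t z) t := by
  have h2 : HasDerivAt (fun s => ∫ z in (A t)..(A s), r s z) (r t (A t) * A') t := by
    -- The mean of `r` over the moving segment; the increment is `q s * (A s - A t)`, and continuity
    -- of `q` at `t` is all that the product needs.
    set q : ℝ → ℝ := fun s => ∫ θ in (0 : ℝ)..1, r s (A t + θ * (A s - A t)) with hq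
    have hqc : ContinuousAt q t := by
      have e : Continuous fun z : (ℝ × ℝ) × ℝ => r z.1.1 (A t + z.2 * (z.1.2 - A t)) :=
        hr.comp (by fun_prop : Continuous fun z : (ℝ × ℝ) × ℝ =>
          (z.1.1, A t + z.2 * (z.1.2 - A t)))
      have h : Continuous fun p : ℝ × ℝ => ∫ θ in (0 : ℝ)..1, r p.1 (A t + θ * (p.2 - A t)) :=
        intervalIntegral.continuous_parametric_intervalIntegral_of_continuous' e 0 1
      exact ContinuousAt.comp (f := fun s => (s, A s)) h.continuousAt
        (continuousAt_id.prodMk hA.continuousAt)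
    have heq : (fun s => ∫ z in (A t)..(A s), r s z) = fun s => q s * (A s - A t) := by
      funext s
      rw [hq, ← sub_eq_mul_integral_segment (continuous_uncurry_left hr s)
        (hasDerivAt_primitive (continuous_uncurry_left hr s) (A t)) (A t) (A s)]
      simp
    rw [heq, hasDerivAt_iff_tendsto_slope]
    have hq0 : q t = r t (A t) := by simp [hq]
    rw [← hq0]
    refine ((hqc.tendsto.mono_left nhdsWithin_le_nhds).mul
      (hasDerivAt_iff_tendsto_slope.1 hA)).congr fun s => ?_
    simp only [slope_def_field, sub_self, mul_zero, sub_zero]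
    rw [mul_div_assoc]
  refine ((h2.add (hasDerivAt_integral_of_continuous hr hrt hS hd 0 (A t)))).congr_of_eventuallyEq
    (Eventually.of_forall fun s => ?_)
  have hi := fun x y => (continuous_uncurry_left hr s).intervalIntegrable (μ := volume) x y
  simp only [Pi.add_apply]
  rw [add_comm, intervalIntegral.integral_add_adjacent_intervals (hi _ _) (hi _ _)]

/-- The mass between two characteristics is constant in time. -/
theorem integral_eq_of_conservation {r rt U : ℝ → ℝ → ℝ} {A B : ℝ → ℝ} {T : ℝ}
    (hr : Continuous fun p : ℝ × ℝ => r p.1 p.2) (hrt : Continuous fun p : ℝ × ℝ => rt p.1 p.2)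
    (hd : ∀ t x, 0 < t → HasDerivAt (fun s => r s x) (rt t x) t)
    (hA : ∀ t ∈ Icc 0 T, HasDerivWithinAt A (U t (A t)) (Icc 0 T) t)
    (hB : ∀ t ∈ Icc 0 T, HasDerivWithinAt B (U t (B t)) (Icc 0 T) t)
    (hAB : ∀ t ∈ Icc 0 T, A t ≤ B t) (hU : ∀ t, Continuous (U t))
    (hflux : ∀ t ∈ Ioo 0 T, ∀ x ∈ Ioo (A t) (B t),
      HasDerivAt (fun y => r t y * U t y) (-(rt t x)) x) {t : ℝ} (ht : t ∈ Icc 0 T) :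
    ∫ y in (A t)..(B t), r t y = ∫ y in (A 0)..(B 0), r 0 y := by
  have hT : (0 : ℝ) ≤ T := ht.1.trans ht.2
  have hP : Continuous fun p : ℝ × ℝ => ∫ z in (0 : ℝ)..p.2, r p.1 z :=
    intervalIntegral.continuous_parametric_primitive_of_continuous hr
  set Φ : ℝ → ℝ := fun s => (∫ z in (0 : ℝ)..(B s), r s z) - ∫ z in (0 : ℝ)..(A s), r s z with hΦ
  have hΦe : ∀ s, ∫ y in (A s)..(B s), r s y = Φ s := fun s =>
    (intervalIntegral.integral_interval_sub_left
      ((continuous_uncurry_left hr s).intervalIntegrable _ _)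
      ((continuous_uncurry_left hr s).intervalIntegrable _ _)).symm
  have hΦc : ContinuousOn Φ (Icc 0 T) := by
    have h : ∀ C : ℝ → ℝ, ContinuousOn C (Icc 0 T) →
        ContinuousOn (fun s => ∫ z in (0 : ℝ)..(C s), r s z) (Icc 0 T) := fun C hC =>
      hP.comp_continuousOn (continuousOn_id.prodMk hC)
    exact (h B fun s hs => (hB s hs).continuousWithinAt).sub
      (h A fun s hs => (hA s hs).continuousWithinAt)
  have hΦd : ∀ s ∈ Ioo 0 T, HasDerivAt Φ 0 s := by
    intro s hs
    have hs' : s ∈ Icc 0 T := Ioo_subset_Icc_self hs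
    have hn := Icc_mem_nhds hs.1 hs.2
    have h1 := hasDerivAt_integral_moving hr hrt (Ioi_mem_nhds hs.1) (fun s h x => hd s x h)
      ((hA s hs').hasDerivAt hn)
    have h2 := hasDerivAt_integral_moving hr hrt (Ioi_mem_nhds hs.1) (fun s h x => hd s x h)
      ((hB s hs').hasDerivAt hn)
    refine (h2.sub h1).congr_deriv ?_
    have hi := fun x y => (continuous_uncurry_left hrt s).intervalIntegrable (μ := volume) x y
    -- The balance law holds in the open interval and the flux is continuous up to its ends. The
    -- boundary fluxes cancel the terms from the moving endpoints.
    have h3 : ∫ z in (A s)..(B s), -(rt s z) = r s (B s) * U s (B s) - r s (A s) * U s (A s) :=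
      intervalIntegral.integral_eq_sub_of_hasDerivAt_of_le (hAB s hs')
        ((continuous_uncurry_left hr s).mul (hU s)).continuousOn
        (fun x hx => hflux s hs x hx) (hi _ _).neg
    rw [intervalIntegral.integral_neg, ← intervalIntegral.integral_interval_sub_left
      (hi 0 _) (hi 0 _)] at h3
    linarith
  rw [hΦe, hΦe]
  rcases ht.1.eq_or_lt with rfl | h0
  · rfl
  -- At time zero only continuity is available, so the mean value theorem is applied on the interval
  -- from zero to `t`.
  obtain ⟨c, hc, hc'⟩ := exists_hasDerivAt_eq_slope Φ (fun _ => 0) h0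
    (hΦc.mono (Icc_subset_Icc_right ht.2)) fun s hs => hΦd s ⟨hs.1, hs.2.trans_le ht.2⟩
  rw [eq_comm, div_eq_zero_iff] at hc'
  rcases hc' with h | h <;> linarith

end

/-! ### The kernel and look-ahead averages. -/

section

/-- The derivative of the kernel, extended continuously to the line by constants. -/
def kernelSlope (η : ℝ) (W : ℝ → ℝ) (z : ℝ) : ℝ := derivWithin W (Icc 0 η) (max 0 (min z η))

/-- A `C¹` extension of the kernel to the line. -/
def kernelExt (η : ℝ) (W : ℝ → ℝ) (z : ℝ) : ℝ := W 0 + ∫ s in (0 : ℝ)..z, kernelSlope η W s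

variable {η : ℝ} {W : ℝ → ℝ}

theorem IsKernel.continuous_slope (hW : IsKernel η W) (hη : 0 < η) :
    Continuous (kernelSlope η W) :=
  (hW.contDiff.continuousOn_derivWithin (uniqueDiffOn_Icc hη) le_rfl).comp_continuous
    (by fun_prop) fun _ => ⟨le_max_left _ _, max_le hη.le (min_le_right _ _)⟩

theorem IsKernel.slope_nonpos (hW : IsKernel η W) (hη : 0 < η) (z : ℝ) :
    kernelSlope η W z ≤ 0 :=
  hW.deriv_nonpos _ ⟨le_max_left _ _, max_le hη.le (min_le_right _ _)⟩

theorem IsKernel.hasDerivAt_ext (hW : IsKernel η W) (hη : 0 < η) (z : ℝ) :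
    HasDerivAt (kernelExt η W) (kernelSlope η W z) z :=
  (hasDerivAt_primitive (hW.continuous_slope hη) 0 z).const_add _

theorem IsKernel.continuous_ext (hW : IsKernel η W) (hη : 0 < η) : Continuous (kernelExt η W) :=
  continuous_iff_continuousAt.2 fun z => (hW.hasDerivAt_ext hη z).continuousAt

theorem IsKernel.ext_eq (hW : IsKernel η W) (hη : 0 < η) {z : ℝ} (hz : z ∈ Icc 0 η) :
    kernelExt η W z = W z := by
  have h := intervalIntegral.integral_eq_sub_of_hasDerivAt_of_le (f := W)
    (f' := kernelSlope η W) hz.1 (hW.contDiff.continuousOn.mono (Icc_subset_Icc_right hz.2))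
    (fun x hx => by
      have hx' : x ∈ Ioo 0 η := ⟨hx.1, hx.2.trans_le hz.2⟩
      have h := ((hW.contDiff.differentiableOn one_ne_zero x
        (Ioo_subset_Icc_self hx')).hasDerivWithinAt).hasDerivAt (Icc_mem_nhds hx'.1 hx'.2)
      rwa [kernelSlope, min_eq_left hx'.2.le, max_eq_right hx'.1.le])
    ((hW.continuous_slope hη).intervalIntegrable _ _)
  rw [kernelExt, h]
  ring

theorem IsKernel.antitone_ext (hW : IsKernel η W) (hη : 0 < η) : Antitone (kernelExt η W) :=
  antitone_of_deriv_nonpos (fun z => (hW.hasDerivAt_ext hη z).differentiableAt) fun z => by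
    rw [(hW.hasDerivAt_ext hη z).deriv]
    exact hW.slope_nonpos hη z

theorem IsKernel.integral_ext (hW : IsKernel η W) (hη : 0 < η) :
    ∫ z in (0 : ℝ)..η, kernelExt η W z = 1 := by
  rw [← hW.integral_eq_one]
  refine intervalIntegral.integral_congr fun z hz => hW.ext_eq hη ?_
  rwa [uIcc_of_le hη.le] at hz

/-- The look-ahead average `∫_0^η W(z) h(x + z) dz`. -/
def lookAhead (η : ℝ) (W : ℝ → ℝ) (h : ℝ → ℝ) (x : ℝ) : ℝ :=
  ∫ z in (0 : ℝ)..η, kernelExt η W z * h (x + z)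

/-- The derivative of the look-ahead average. -/
def lookAheadDeriv (η : ℝ) (W : ℝ → ℝ) (h : ℝ → ℝ) (x : ℝ) : ℝ :=
  kernelExt η W η * h (x + η) - W 0 * h x - ∫ z in (0 : ℝ)..η, kernelSlope η W z * h (x + z)

/-- The speed `h` is merely continuous, so the kernel has to carry the derivative: an integration by
parts rewrites the average through the C¹ primitive `H` of `h`. -/
theorem IsKernel.hasDerivAt_lookAhead (hW : IsKernel η W) (hη : 0 < η) {h : ℝ → ℝ}
    (hh : Continuous h) (x : ℝ) :
    HasDerivAt (lookAhead η W h) (lookAheadDeriv η W h x) x := by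
  set H : ℝ → ℝ := fun y => ∫ s in (0 : ℝ)..y, h s with hH
  have hHd : ∀ y, HasDerivAt H (h y) y := hasDerivAt_primitive hh 0
  have hHc : Continuous H := continuous_iff_continuousAt.2 fun y => (hHd y).continuousAt
  have hk := hW.continuous_slope hη
  have h0 : kernelExt η W 0 = W 0 := by simp [kernelExt]
  have heq : lookAhead η W h = fun x => kernelExt η W η * H (x + η) - W 0 * H x -
      ∫ z in (0 : ℝ)..η, kernelSlope η W z * H (x + z) := by
    funext x
    rw [lookAhead, intervalIntegral.integral_mul_deriv_eq_deriv_mul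
      (u := kernelExt η W) (v := fun z => H (x + z)) (u' := kernelSlope η W)
      (v' := fun z => h (x + z)) (fun z _ => hW.hasDerivAt_ext hη z)
      (fun z _ => (hHd (x + z)).comp_const_add x z)
      (hk.intervalIntegrable _ _) (Continuous.intervalIntegrable (by fun_prop) _ _), h0, add_zero]
  rw [heq]
  have e1 : Continuous fun p : ℝ × ℝ => kernelSlope η W p.2 * H (p.1 + p.2) := by fun_prop
  have e2 : Continuous fun p : ℝ × ℝ => kernelSlope η W p.2 * h (p.1 + p.2) := by fun_prop
  have h3 := hasDerivAt_integral_of_continuous (r := fun x z => kernelSlope η W z * H (x + z))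
    (rt := fun x z => kernelSlope η W z * h (x + z)) e1 e2 (t := x) univ_mem
    (fun s _ z => ((hHd (s + z)).comp_add_const s z).const_mul _) 0 η
  exact ((((hHd (x + η)).comp_add_const x η).const_mul _).sub ((hHd x).const_mul _)).sub h3

theorem IsKernel.continuous_lookAhead (hW : IsKernel η W) (hη : 0 < η) {h : ℝ → ℝ → ℝ}
    (hh : Continuous fun p : ℝ × ℝ => h p.1 p.2) :
    Continuous fun p : ℝ × ℝ => lookAhead η W (h p.1) p.2 := by
  have e : Continuous fun q : (ℝ × ℝ) × ℝ => kernelExt η W q.2 * h q.1.1 (q.1.2 + q.2) :=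
    ((hW.continuous_ext hη).comp continuous_snd).mul
      (hh.comp (by fun_prop : Continuous fun q : (ℝ × ℝ) × ℝ => (q.1.1, q.1.2 + q.2)))
  exact intervalIntegral.continuous_parametric_intervalIntegral_of_continuous' e 0 η

theorem IsKernel.continuous_lookAheadDeriv (hW : IsKernel η W) (hη : 0 < η) {h : ℝ → ℝ → ℝ}
    (hh : Continuous fun p : ℝ × ℝ => h p.1 p.2) :
    Continuous fun p : ℝ × ℝ => lookAheadDeriv η W (h p.1) p.2 := by
  have e : Continuous fun q : (ℝ × ℝ) × ℝ => kernelSlope η W q.2 * h q.1.1 (q.1.2 + q.2) :=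
    ((hW.continuous_slope hη).comp continuous_snd).mul
      (hh.comp (by fun_prop : Continuous fun q : (ℝ × ℝ) × ℝ => (q.1.1, q.1.2 + q.2)))
  have e1 : Continuous fun q : ℝ × ℝ => h q.1 (q.2 + η) :=
    hh.comp (by fun_prop : Continuous fun q : ℝ × ℝ => (q.1, q.2 + η))
  exact ((continuous_const.mul e1).sub (continuous_const.mul hh)).sub
    (intervalIntegral.continuous_parametric_intervalIntegral_of_continuous' e 0 η)

theorem abs_integral_mul_le {k g : ℝ → ℝ} {C M : ℝ} (hη : 0 ≤ η)
    (hk : ∀ z ∈ Icc 0 η, |k z| ≤ C) (hg : ∀ z, |g z| ≤ M) :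
    |∫ z in (0 : ℝ)..η, k z * g z| ≤ C * M * η := by
  have h := intervalIntegral.norm_integral_le_of_norm_le_const (a := 0) (b := η)
    (f := fun z => k z * g z) (C := C * M) fun z hz => by
      rw [uIoc_of_le hη] at hz
      rw [norm_mul]
      exact mul_le_mul (hk z (Ioc_subset_Icc_self hz)) (hg z) (norm_nonneg _)
        ((abs_nonneg _).trans (hk z (Ioc_subset_Icc_self hz)))
  rwa [sub_zero, abs_of_nonneg hη] at h

theorem IsKernel.exists_slope_bound (hW : IsKernel η W) (hη : 0 < η) :
    ∃ C, 0 ≤ C ∧ ∀ z ∈ Icc 0 η, |kernelSlope η W z| ≤ C := by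
  obtain ⟨C, hC⟩ := (isCompact_Icc (a := (0 : ℝ)) (b := η)).bddAbove_image
    (hW.continuous_slope hη).abs.continuousOn
  have h : ∀ z ∈ Icc 0 η, |kernelSlope η W z| ≤ C := fun z hz => hC ⟨z, hz, rfl⟩
  exact ⟨C, (abs_nonneg _).trans (h 0 (left_mem_Icc.2 hη.le)), h⟩

theorem IsKernel.exists_lookAhead_bound (hW : IsKernel η W) (hη : 0 < η) (M : ℝ) :
    ∃ B, ∀ h : ℝ → ℝ, (∀ y, |h y| ≤ M) → ∀ x, |lookAhead η W h x| ≤ B := by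
  obtain ⟨C, hC⟩ := (isCompact_Icc (a := (0 : ℝ)) (b := η)).bddAbove_image
    (hW.continuous_ext hη).abs.continuousOn
  exact ⟨C * M * η, fun h hh x => abs_integral_mul_le (g := fun z => h (x + z)) hη.le
    (fun z hz => hC ⟨z, hz, rfl⟩) fun z => hh _⟩

theorem IsKernel.exists_lookAheadDeriv_bound (hW : IsKernel η W) (hη : 0 < η) (M : ℝ) :
    ∃ K, ∀ h : ℝ → ℝ, (∀ y, |h y| ≤ M) → ∀ x, |lookAheadDeriv η W h x| ≤ K := by
  obtain ⟨C, -, hC⟩ := hW.exists_slope_bound hη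
  refine ⟨|kernelExt η W η| * M + |W 0| * M + C * M * η, fun h hh x => ?_⟩
  have h1 := abs_integral_mul_le (g := fun z => h (x + z)) hη.le hC fun z => hh _
  have h2 : |kernelExt η W η * h (x + η)| ≤ |kernelExt η W η| * M := by
    rw [abs_mul]; exact mul_le_mul_of_nonneg_left (hh _) (abs_nonneg _)
  have h3 : |W 0 * h x| ≤ |W 0| * M := by
    rw [abs_mul]; exact mul_le_mul_of_nonneg_left (hh _) (abs_nonneg _)
  refine (abs_sub _ _).trans (add_le_add ((abs_sub _ _).trans (add_le_add h2 h3)) h1)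

/-- If `h` equals the constant `c` beyond the look-ahead horizon, only `h - c` matters. -/
theorem IsKernel.lookAheadDeriv_eq (hW : IsKernel η W) (hη : 0 < η) {h : ℝ → ℝ}
    (hh : Continuous h) {x c : ℝ} (hc : h (x + η) = c) :
    lookAheadDeriv η W h x =
      -(W 0 * (h x - c)) - ∫ z in (0 : ℝ)..η, kernelSlope η W z * (h (x + z) - c) := by
  have hk := hW.continuous_slope hη
  have h1 : ∫ z in (0 : ℝ)..η, kernelSlope η W z * (h (x + z) - c) =
      (∫ z in (0 : ℝ)..η, kernelSlope η W z * h (x + z)) -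
        (∫ z in (0 : ℝ)..η, kernelSlope η W z) * c := by
    rw [← intervalIntegral.integral_mul_const, ← intervalIntegral.integral_sub
      (Continuous.intervalIntegrable (by fun_prop) _ _)
      (Continuous.intervalIntegrable (by fun_prop) _ _)]
    simp_rw [mul_sub]
  rw [h1, lookAheadDeriv, hc, kernelExt]
  ring

theorem IsKernel.lookAhead_nonneg (hW : IsKernel η W) (hη : 0 < η) {h : ℝ → ℝ}
    (hh : ∀ y, 0 ≤ h y) (x : ℝ) : 0 ≤ lookAhead η W h x :=
  intervalIntegral.integral_nonneg hη.le fun z hz => by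
    rw [hW.ext_eq hη hz]
    exact mul_nonneg (hW.nonneg z hz) (hh _)

theorem IsKernel.lookAhead_eq_const (hW : IsKernel η W) (hη : 0 < η) {h : ℝ → ℝ} {x c : ℝ}
    (hh : ∀ y, x ≤ y → h y = c) : lookAhead η W h x = c := by
  have : lookAhead η W h x = ∫ z in (0 : ℝ)..η, kernelExt η W z * c :=
    intervalIntegral.integral_congr fun z hz => by
      rw [uIcc_of_le hη.le] at hz
      rw [hh _ (by linarith [hz.1])]
  rw [this, intervalIntegral.integral_mul_const, hW.integral_ext hη, one_mul]

end

/-! ### The velocity function and the equilibrium density. -/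

section

variable {v : ℝ → ℝ → ℝ} {ρmax : ℝ → ℝ}

/-- Existence is the intermediate value theorem between `v 0 w = w` and `v (ρmax w) w = 0`. The
solution set is compact, so its supremum is itself a solution, without any appeal to uniqueness. -/
theorem IsVelocity.eqDensity_spec (hv : IsVelocity v ρmax) {vbar w : ℝ} (hvbar : 0 < vbar)
    (hw : vbar ≤ w) : eqDensity v ρmax vbar w ∈ Icc 0 (ρmax w) ∧
      v (eqDensity v ρmax vbar w) w = vbar := by
  have hw0 : 0 < w := hvbar.trans_le hw
  have hc : ContinuousOn (fun r => v r w) (Icc 0 (ρmax w)) := (hv.contDiff_density w hw0).continuousOn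
  have hivt := intermediate_value_Icc' (hv.rhoMax_pos w hw0).le hc
  simp only [hv.apply_rhoMax w hw0, hv.apply_zero_left w hw0.le] at hivt
  obtain ⟨r, hr, hr'⟩ := hivt ⟨hvbar.le, hw⟩
  have hcomp : IsCompact {r | 0 ≤ r ∧ r ≤ ρmax w ∧ v r w = vbar} := by
    have h := hc.preimage_isClosed_of_isClosed isClosed_Icc (isClosed_singleton (x := vbar))
    convert isCompact_Icc.of_isClosed_subset h inter_subset_left using 1
    ext r
    simp [and_assoc]
  have h := hcomp.sSup_mem ⟨r, hr.1, hr.2, hr'⟩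
  exact ⟨⟨h.1, h.2.1⟩, h.2.2⟩

/-- An upper bound on `∂_ρ v(·, w)` bounds the increments. -/
theorem IsVelocity.sub_le (hv : IsVelocity v ρmax) {w m : ℝ} (hw : 0 < w)
    (hm : ∀ r ∈ Icc 0 (ρmax w), derivWithin (fun s => v s w) (Icc 0 (ρmax w)) r ≤ m) {r s : ℝ}
    (hr : r ∈ Icc 0 (ρmax w)) (hs : s ∈ Icc 0 (ρmax w)) (hrs : r ≤ s) :
    v s w - v r w ≤ m * (s - r) := by
  have hcd := hv.contDiff_density w hw
  refine (convex_Icc 0 (ρmax w)).image_sub_le_mul_sub_of_deriv_le hcd.continuousOn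
    ((hcd.differentiableOn two_ne_zero).mono interior_subset) (fun x hx => ?_) r hr s hs hrs
  rw [← derivWithin_of_mem_nhds (mem_interior_iff_mem_nhds.1 hx)]
  exact hm x (interior_subset hx)

/-- Strong monotonicity of `-v` in the density: this is the source of the decay rate. -/
theorem IsVelocity.sub_mul_sub_ge (hv : IsVelocity v ρmax) {w m : ℝ} (hw : 0 < w)
    (hm : ∀ r ∈ Icc 0 (ρmax w), derivWithin (fun s => v s w) (Icc 0 (ρmax w)) r ≤ m) {r s : ℝ}
    (hr : r ∈ Icc 0 (ρmax w)) (hs : s ∈ Icc 0 (ρmax w)) :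
    -m * (s - r) ^ 2 ≤ (v r w - v s w) * (s - r) := by
  rcases le_total r s with h | h
  · have := mul_le_mul_of_nonneg_right (hv.sub_le hw hm hr hs h) (sub_nonneg.2 h)
    linarith [sq (s - r)]
  · have := mul_le_mul_of_nonneg_right (hv.sub_le hw hm hs hr h) (sub_nonneg.2 h)
    nlinarith [this]

theorem IsVelocity.exists_sub_le (hv : IsVelocity v ρmax) {w : ℝ} (hw : 0 < w) :
    ∃ Λ, 0 ≤ Λ ∧ ∀ r ∈ Icc 0 (ρmax w), ∀ s ∈ Icc 0 (ρmax w), |v r w - v s w| ≤ Λ * |r - s| := by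
  obtain ⟨K, hK⟩ := ((hv.contDiff_density w hw).of_le one_le_two).exists_lipschitzOnWith
    one_ne_zero (convex_Icc _ _) isCompact_Icc
  exact ⟨K, K.2, fun r hr s hs => by simpa [Real.dist_eq] using hK.dist_le_mul r hr s hs⟩

/-- The equilibrium density depends continuously on the marker. -/
theorem IsVelocity.continuousOn_eqDensity (hv : IsVelocity v ρmax) {vbar m : ℝ} (hvbar : 0 < vbar)
    (hm : m < 0) {S : Set ℝ} (hS : ∀ w ∈ S, vbar ≤ w ∧
      ∀ r ∈ Icc 0 (ρmax w), derivWithin (fun s => v s w) (Icc 0 (ρmax w)) r ≤ m) :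
    ContinuousOn (eqDensity v ρmax vbar) S := by
  intro w₀ hw₀
  obtain ⟨hw₀v, hd₀⟩ := hS w₀ hw₀
  have hp₀ : 0 < w₀ := hvbar.trans_le hw₀v
  obtain ⟨hr₀, hv₀⟩ := hv.eqDensity_spec hvbar hw₀v
  set r₀ := eqDensity v ρmax vbar w₀
  set D : Set (ℝ × ℝ) := {p : ℝ × ℝ | 0 < p.2 ∧ 0 ≤ p.1 ∧ p.1 ≤ ρmax p.2} with hD
  rw [ContinuousWithinAt, tendsto_order]
  constructor
  · intro q hq
    rcases lt_or_ge q 0 with hq0 | hq0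
    · filter_upwards [self_mem_nhdsWithin] with w hw
      exact hq0.trans_le (hv.eqDensity_spec hvbar (hS w hw).1).1.1
    -- Comparing at `q` alone is not enough, since `q` may exceed `ρmax w` for nearby `w`. Every
    -- density in the compact interval `[0, q]` is excluded instead, uniformly for `w` near `w₀`.
    have hloc : ∀ p ∈ Icc 0 q, ∀ᶠ z : ℝ × ℝ in 𝓝 (w₀, p), (z.2, z.1) ∈ D → vbar < v z.2 z.1 := by
      intro p hp
      have hpI : p ∈ Icc 0 (ρmax w₀) := ⟨hp.1, hp.2.trans (hq.le.trans hr₀.2)⟩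
      have h1 := hv.sub_le hp₀ hd₀ hpI hr₀ (hp.2.trans hq.le)
      have h2 : vbar < v p w₀ := by nlinarith [hp.2]
      have h3 : ∀ᶠ z in 𝓝[D] (p, w₀), vbar < v z.1 z.2 :=
        (hv.continuous (p, w₀) ⟨hp₀, hpI⟩).eventually_const_lt h2
      rw [eventually_nhdsWithin_iff] at h3
      exact (continuous_swap.tendsto (w₀, p)).eventually h3
    have h := (isCompact_Icc (a := (0 : ℝ)) (b := q)).eventually_forall_of_forall_eventually
      (x₀ := w₀) (P := fun w p => (p, w) ∈ D → vbar < v p w) hloc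
    filter_upwards [self_mem_nhdsWithin, nhdsWithin_le_nhds h] with w hw hwq
    by_contra! hle
    obtain ⟨hr, hvr⟩ := hv.eqDensity_spec hvbar (hS w hw).1
    have := hwq _ ⟨hr.1, hle⟩ ⟨hvbar.trans_le (hS w hw).1, hr⟩
    simp only [hvr] at this
    exact lt_irrefl _ this
  · intro q' hq'
    have hlt : r₀ < ρmax w₀ := lt_of_le_of_ne hr₀.2 fun h => by
      rw [h, hv.apply_rhoMax w₀ hp₀] at hv₀
      exact hvbar.ne hv₀
    set q := min ((r₀ + q') / 2) (ρmax w₀)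
    have hq1 : r₀ < q := lt_min (by linarith) hlt
    have hq2 : q < q' := (min_le_left _ _).trans_lt (by linarith)
    have hqI : q ∈ Icc 0 (ρmax w₀) := ⟨hr₀.1.trans hq1.le, min_le_right _ _⟩
    have h1 := hv.sub_le hp₀ hd₀ hr₀ hqI hq1.le
    have h2 : v q w₀ < vbar := by nlinarith
    have h3 : ∀ᶠ z in 𝓝[D] (q, w₀), v z.1 z.2 < vbar :=
      (hv.continuous (q, w₀) ⟨hp₀, hqI⟩).eventually_lt_const h2
    rw [eventually_nhdsWithin_iff] at h3
    have hcq : Continuous fun w : ℝ => (q, w) := by fun_prop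
    have h4 := (hcq.tendsto w₀).eventually h3
    filter_upwards [self_mem_nhdsWithin, nhdsWithin_le_nhds h4] with w hw hwq
    by_contra! hle
    obtain ⟨hwv, hd⟩ := hS w hw
    obtain ⟨hr, hvr⟩ := hv.eqDensity_spec hvbar hwv
    -- Here one comparison point suffices: an equilibrium density above `q` forces `q` to be
    -- admissible for `w`.
    have hqI' : q ∈ Icc 0 (ρmax w) := ⟨hqI.1, (hq2.le.trans hle).trans hr.2⟩
    have h5 := hwq ⟨hvbar.trans_le hwv, hqI'⟩
    have h6 := hv.sub_le (hvbar.trans_le hwv) hd hqI' hr (hq2.le.trans hle)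
    simp only [hvr] at h5 h6
    nlinarith

end

/-! ### The flow of the nonlocal velocity. -/

section

/-- The Jacobian `∂_ξ X(t, ξ)` of the flow of the look-ahead average of `h`. -/
def jacobian (η : ℝ) (W : ℝ → ℝ) (h X : ℝ → ℝ → ℝ) (t ξ : ℝ) : ℝ :=
  Real.exp (∫ s in (0 : ℝ)..t, lookAheadDeriv η W (h s) (X s ξ))

/-- `X` is the flow on `[0, T]` of the look-ahead average of the local speed `h`. -/
structure IsSpeedFlow (η T : ℝ) (W : ℝ → ℝ) (h X : ℝ → ℝ → ℝ) : Prop where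
  continuous_speed : Continuous fun p : ℝ × ℝ => h p.1 p.2
  continuous_flow : Continuous fun p : ℝ × ℝ => X p.1 p.2
  flow_zero : ∀ ξ, X 0 ξ = ξ
  time_deriv : ∀ ξ, ∀ t ∈ Icc 0 T,
    HasDerivWithinAt (fun s => X s ξ) (lookAhead η W (h t) (X t ξ)) (Icc 0 T) t
  space_deriv : ∀ t ∈ Icc 0 T, ∀ ξ, HasDerivAt (X t) (jacobian η W h X t ξ) ξ

variable {η T : ℝ} {W : ℝ → ℝ}

theorem exists_speedFlow (hW : IsKernel η W) (hη : 0 < η) (hT : 0 ≤ T) {h : ℝ → ℝ → ℝ}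
    (hh : Continuous fun p : ℝ × ℝ => h p.1 p.2) {M : ℝ} (hM : ∀ t y, |h t y| ≤ M) :
    ∃ X, IsSpeedFlow η T W h X := by
  obtain ⟨B, hB⟩ := hW.exists_lookAhead_bound hη M
  obtain ⟨K, hK⟩ := hW.exists_lookAheadDeriv_bound hη M
  obtain ⟨X, h1, h2, h3, h4⟩ := exists_flow (hW.continuous_lookAhead hη hh)
    (hW.continuous_lookAheadDeriv hη hh)
    (fun t x => hW.hasDerivAt_lookAhead hη (continuous_uncurry_left hh t) x)
    (fun t x => hB (h t) (hM t) x) (fun t x => hK (h t) (hM t) x) hT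
  exact ⟨X, hh, h1, h2, h3, h4⟩

namespace IsSpeedFlow

variable {h X : ℝ → ℝ → ℝ}

theorem continuous_lookAheadDeriv (hX : IsSpeedFlow η T W h X) (hW : IsKernel η W) (hη : 0 < η) :
    Continuous fun p : ℝ × ℝ => lookAheadDeriv η W (h p.1) (X p.1 p.2) :=
  (hW.continuous_lookAheadDeriv hη hX.continuous_speed).comp
    (continuous_fst.prodMk hX.continuous_flow)

theorem hasDerivAt_jacobian (hX : IsSpeedFlow η T W h X) (hW : IsKernel η W) (hη : 0 < η)
    (t ξ : ℝ) : HasDerivAt (fun s => jacobian η W h X s ξ)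
      (lookAheadDeriv η W (h t) (X t ξ) * jacobian η W h X t ξ) t := by
  have := (hasDerivAt_primitive
    (continuous_uncurry_right (f := fun s ξ => lookAheadDeriv η W (h s) (X s ξ))
      (hX.continuous_lookAheadDeriv hW hη) ξ) 0 t).exp
  rwa [mul_comm] at this

theorem continuous_jacobian (hX : IsSpeedFlow η T W h X) (hW : IsKernel η W) (hη : 0 < η) :
    Continuous fun p : ℝ × ℝ => jacobian η W h X p.1 p.2 := by
  have e : Continuous fun q : (ℝ × ℝ) × ℝ => lookAheadDeriv η W (h q.2) (X q.2 q.1.2) :=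
    (hX.continuous_lookAheadDeriv hW hη).comp
      (by fun_prop : Continuous fun q : (ℝ × ℝ) × ℝ => (q.2, q.1.2))
  exact Real.continuous_exp.comp
    (intervalIntegral.continuous_parametric_intervalIntegral_of_continuous e continuous_fst)

theorem jacobian_pos (t ξ : ℝ) : 0 < jacobian η W h X t ξ := Real.exp_pos _

theorem jacobian_zero (ξ : ℝ) : jacobian η W h X 0 ξ = 1 := by simp [jacobian]

theorem strictMono (hX : IsSpeedFlow η T W h X) {t : ℝ} (ht : t ∈ Icc 0 T) : StrictMono (X t) :=
  strictMono_of_deriv_pos fun ξ => by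
    rw [(hX.space_deriv t ht ξ).deriv]
    exact jacobian_pos t ξ

/-- Every solution of `Y' = V(t, Y)` is a trajectory of the flow. -/
theorem eq_of_solution (hX : IsSpeedFlow η T W h X) (hW : IsKernel η W) (hη : 0 < η) {Y : ℝ → ℝ}
    (hYc : Continuous Y) (hY : ∀ t ∈ Icc 0 T,
      HasDerivWithinAt Y (lookAhead η W (h t) (Y t)) (Icc 0 T) t) {t : ℝ} (ht : t ∈ Icc 0 T) :
    X t (Y 0) = Y t := by
  have hXc := continuous_uncurry_right hX.continuous_flow (Y 0)
  have hVx := hW.continuous_lookAheadDeriv hη hX.continuous_speed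
  have e : Continuous fun q : ℝ × ℝ =>
      lookAheadDeriv η W (h q.1) (Y q.1 + q.2 * (X q.1 (Y 0) - Y q.1)) :=
    hVx.comp (f := fun q : ℝ × ℝ => (q.1, Y q.1 + q.2 * (X q.1 (Y 0) - Y q.1))) (by fun_prop)
  have hc := intervalIntegral.continuous_parametric_intervalIntegral_of_continuous'
    (μ := volume)
    (f := fun t θ => lookAheadDeriv η W (h t) (Y t + θ * (X t (Y 0) - Y t))) e 0 1
  -- The difference of the two trajectories solves a linear equation with zero initial value.
  have := eq_mul_exp_of_linear (D := fun s => X s (Y 0) - Y s) hc (fun s hs => by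
    refine ((hX.time_deriv (Y 0) s hs).sub (hY s hs)).congr_deriv ?_
    exact sub_eq_mul_integral_segment (f' := lookAheadDeriv η W (h s))
      (continuous_uncurry_left (f := fun t x => lookAheadDeriv η W (h t) x) hVx s)
      (hW.hasDerivAt_lookAhead hη (continuous_uncurry_left hX.continuous_speed s)) _ _) ht
  simp only [hX.flow_zero, sub_self, zero_mul] at this
  linarith

theorem le_flow (hX : IsSpeedFlow η T W h X) (hW : IsKernel η W) (hη : 0 < η)
    (hh : ∀ t y, 0 ≤ h t y) {t : ℝ} (ht : t ∈ Icc 0 T) (ξ : ℝ) : ξ ≤ X t ξ := by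
  have hm : MonotoneOn (fun s => X s ξ) (Icc 0 T) :=
    monotoneOn_of_hasDerivWithinAt_nonneg (convex_Icc 0 T)
      (continuous_uncurry_right hX.continuous_flow ξ).continuousOn
      (fun s hs => (hX.time_deriv ξ s (interior_subset hs)).mono interior_subset)
      fun s _ => hW.lookAhead_nonneg hη (hh s) _
  have := hm ⟨le_rfl, ht.1.trans ht.2⟩ ht ht.1
  simpa only [hX.flow_zero] using this

end IsSpeedFlow

variable {a b vbar : ℝ} {v : ℝ → ℝ → ℝ} {ρmax ρ₀ ω₀ : ℝ → ℝ} {ρ ω : ℝ → ℝ → ℝ}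

/-- The local speed `v(ρ, ω)`, extended by constants from `[0, T]` and `[a, β(t)]`. -/
def localSpeed (a b vbar T : ℝ) (v ρ ω : ℝ → ℝ → ℝ) (t y : ℝ) : ℝ :=
  v (ρ (max 0 (min t T)) (max a (min y (leader b vbar (max 0 (min t T))))))
    (ω (max 0 (min t T)) (max a (min y (leader b vbar (max 0 (min t T))))))

theorem clampTime_eq {t : ℝ} (ht : t ∈ Icc 0 T) : max 0 (min t T) = t := by
  rw [min_eq_left ht.2, max_eq_right ht.1]

theorem localSpeed_eq {t y : ℝ} (ht : t ∈ Icc 0 T) (hy : y ∈ Icc a (leader b vbar t)) :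
    localSpeed a b vbar T v ρ ω t y = v (ρ t y) (ω t y) := by
  rw [localSpeed, clampTime_eq ht, min_eq_left hy.2, max_eq_right hy.1]

theorem le_leader (hvbar : 0 < vbar) {t : ℝ} (ht : 0 ≤ t) : b ≤ leader b vbar t := by
  have := mul_nonneg ht hvbar.le
  rw [leader]; linarith

theorem continuous_leader : Continuous (leader b vbar) := by
  unfold leader; fun_prop

theorem clamp_mem_domain (hab : a ≤ b) (hvbar : 0 < vbar) (T t y : ℝ) :
    0 ≤ max 0 (min t T) ∧ a ≤ max a (min y (leader b vbar (max 0 (min t T)))) ∧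
      max a (min y (leader b vbar (max 0 (min t T)))) ≤ leader b vbar (max 0 (min t T)) :=
  ⟨le_max_left _ _, le_max_left _ _,
    max_le (hab.trans (le_leader hvbar (le_max_left _ _))) (min_le_right _ _)⟩

namespace IsSolution

theorem continuous_localSpeed (hsol : IsSolution a b η vbar W v ρmax ρ₀ ω₀ ρ ω) (hab : a ≤ b)
    (hvbar : 0 < vbar) (hv : IsVelocity v ρmax)
    (hρ : ContinuousOn (fun p : ℝ × ℝ => ρ p.1 p.2) (Ici 0 ×ˢ univ)) :
    Continuous fun p : ℝ × ℝ => localSpeed a b vbar T v ρ ω p.1 p.2 := by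
  have hβ : Continuous (leader b vbar) := continuous_leader
  have hc : Continuous fun p : ℝ × ℝ =>
      (max 0 (min p.1 T), max a (min p.2 (leader b vbar (max 0 (min p.1 T))))) := by fun_prop
  have h1 := hρ.comp_continuous hc fun p => ⟨(clamp_mem_domain hab hvbar T p.1 p.2).1, mem_univ _⟩
  have h2 := hsol.marker_continuous.comp_continuous hc fun p =>
    clamp_mem_domain hab hvbar T p.1 p.2
  refine hv.continuous.comp_continuous (h1.prodMk h2) fun p => ?_
  obtain ⟨d1, d2, d3⟩ := clamp_mem_domain hab hvbar T p.1 p.2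
  exact hsol.mem_domain _ _ d1 d2 d3

theorem localSpeed_nonneg (hsol : IsSolution a b η vbar W v ρmax ρ₀ ω₀ ρ ω) (hab : a ≤ b)
    (hvbar : 0 < vbar) (hv : IsVelocity v ρmax) (t y : ℝ) :
    0 ≤ localSpeed a b vbar T v ρ ω t y := by
  obtain ⟨d1, d2, d3⟩ := clamp_mem_domain hab hvbar T t y
  obtain ⟨e1, e2⟩ := hsol.mem_domain _ _ d1 d2 d3
  exact hv.nonneg _ e1 _ e2

theorem exists_localSpeed_bound (hsol : IsSolution a b η vbar W v ρmax ρ₀ ω₀ ρ ω) (hab : a ≤ b)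
    (hvbar : 0 < vbar) (hT : 0 ≤ T) (hv : IsVelocity v ρmax)
    (hρ : ContinuousOn (fun p : ℝ × ℝ => ρ p.1 p.2) (Ici 0 ×ˢ univ)) :
    ∃ M, ∀ t y, |localSpeed a b vbar T v ρ ω t y| ≤ M := by
  obtain ⟨M, hM⟩ := ((isCompact_Icc (a := (0 : ℝ)) (b := T)).prod
    (isCompact_Icc (a := a) (b := leader b vbar T))).bddAbove_image
    (hsol.continuous_localSpeed hab hvbar hv hρ).abs.continuousOn
  refine ⟨M, fun t y => ?_⟩
  obtain ⟨d1, d2, d3⟩ := clamp_mem_domain hab hvbar T t y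
  have hτ : max 0 (min t T) ∈ Icc 0 T := ⟨d1, max_le hT (min_le_right _ _)⟩
  have hle : leader b vbar (max 0 (min t T)) ≤ leader b vbar T := by
    have := mul_le_mul_of_nonneg_right hτ.2 hvbar.le
    simp only [leader]; linarith
  have h := hM ⟨(max 0 (min t T), max a (min y (leader b vbar (max 0 (min t T))))),
    ⟨hτ, d2, d3.trans hle⟩, rfl⟩
  beta_reduce at h
  rw [localSpeed_eq hτ ⟨d2, d3⟩] at h
  exact h

theorem localSpeed_eq_vbar (hsol : IsSolution a b η vbar W v ρmax ρ₀ ω₀ ρ ω) (hη : 0 < η)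
    (hab : a ≤ b) (hvbar : 0 < vbar) (hv : IsVelocity v ρmax) (hωb : vbar ≤ ω₀ b) {t y : ℝ}
    (ht : t ∈ Icc 0 T) (hy : leader b vbar t ≤ y) : localSpeed a b vbar T v ρ ω t y = vbar := by
  rw [localSpeed, clampTime_eq ht, min_eq_right hy,
    max_eq_right (hab.trans (le_leader hvbar ht.1)),
    hsol.density_right t _ ht.1 le_rfl (by linarith),
    hsol.marker_right t _ ht.1 le_rfl (by linarith)]
  exact (hv.eqDensity_spec hvbar hωb).2

/-- The window `[x, x + η]` may reach past the leader, but there the leader condition gives the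
speed `v̄`, which is also the value of the constant extension. -/
theorem nonlocalVelocity_eq (hsol : IsSolution a b η vbar W v ρmax ρ₀ ω₀ ρ ω) (hW : IsKernel η W)
    (hη : 0 < η) (hab : a ≤ b) (hvbar : 0 < vbar) (hv : IsVelocity v ρmax) (hωb : vbar ≤ ω₀ b)
    {t x : ℝ} (ht : t ∈ Icc 0 T) (hx : x ∈ Icc a (leader b vbar t)) :
    nonlocalVelocity η W v ρ ω t x = lookAhead η W (localSpeed a b vbar T v ρ ω t) x := by
  have h := intervalIntegral.integral_comp_add_left (a := 0) (b := η)
    (fun y => W (y - x) * v (ρ t y) (ω t y)) x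
  rw [add_zero] at h
  rw [nonlocalVelocity, ← h, lookAhead]
  refine intervalIntegral.integral_congr fun z hz => ?_
  rw [uIcc_of_le hη.le] at hz
  simp only [add_sub_cancel_left, hW.ext_eq hη hz]
  congr 1
  rcases le_total (x + z) (leader b vbar t) with hle | hle
  · exact (localSpeed_eq ht ⟨by linarith [hx.1, hz.1], hle⟩).symm
  · have hr : x + z ≤ leader b vbar t + η := by linarith [hx.2, hz.2]
    rw [hsol.localSpeed_eq_vbar hη hab hvbar hv hωb ht hle, hsol.density_right t _ ht.1 hle hr,
      hsol.marker_right t _ ht.1 hle hr]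
    exact (hv.eqDensity_spec hvbar hωb).2

end IsSolution

end

/-! ### Transport of marker, mass and density along the flow. -/

section

/-- The standing assumptions: a solution with `C¹([0,∞); H²(ℝ))` density whose initial marker is
at least `v̄`. -/
structure IsRegularSolution (a b η vbar : ℝ) (W : ℝ → ℝ) (v : ℝ → ℝ → ℝ) (ρmax ρ₀ ω₀ : ℝ → ℝ)
    (ρ ω : ℝ → ℝ → ℝ) : Prop where
  horizon_pos : 0 < η
  lt_length : a + η < b
  vbar_pos : 0 < vbar
  kernel : IsKernel η W
  velocity : IsVelocity v ρmax
  vbar_le_marker : ∀ x ∈ Icc a b, vbar ≤ ω₀ x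
  solution : IsSolution a b η vbar W v ρmax ρ₀ ω₀ ρ ω
  regular : IsC1H2 ρ

variable {a b η vbar T : ℝ} {W : ℝ → ℝ} {v : ℝ → ℝ → ℝ} {ρmax ρ₀ ω₀ : ℝ → ℝ}
  {ρ ω X : ℝ → ℝ → ℝ}

namespace IsRegularSolution

theorem a_lt_b (S : IsRegularSolution a b η vbar W v ρmax ρ₀ ω₀ ρ ω) : a < b := by
  linarith [S.lt_length, S.horizon_pos]

theorem vbar_le_marker_right (S : IsRegularSolution a b η vbar W v ρmax ρ₀ ω₀ ρ ω) :
    vbar ≤ ω₀ b := S.vbar_le_marker b ⟨S.a_lt_b.le, le_rfl⟩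

theorem exists_speedFlow (S : IsRegularSolution a b η vbar W v ρmax ρ₀ ω₀ ρ ω) (hT : 0 ≤ T) :
    ∃ X, IsSpeedFlow η T W (localSpeed a b vbar T v ρ ω) X := by
  have hρ := S.regular.exists_timeDeriv.1
  obtain ⟨M, hM⟩ := S.solution.exists_localSpeed_bound S.a_lt_b.le S.vbar_pos hT S.velocity hρ
  exact NonlocalGARZ.exists_speedFlow S.kernel S.horizon_pos hT
    (S.solution.continuous_localSpeed S.a_lt_b.le S.vbar_pos S.velocity hρ) hM

/-- The leader sees only the speed `v̄` ahead, and the kernel has unit mass; so the leader path is a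
trajectory, and trajectories are unique. -/
theorem flow_right (S : IsRegularSolution a b η vbar W v ρmax ρ₀ ω₀ ρ ω)
    (hX : IsSpeedFlow η T W (localSpeed a b vbar T v ρ ω) X) {t : ℝ} (ht : t ∈ Icc 0 T) :
    X t b = leader b vbar t := by
  have h0 : leader b vbar 0 = b := by simp [leader]
  have := hX.eq_of_solution S.kernel S.horizon_pos (Y := leader b vbar) continuous_leader
    (fun s hs => by
      rw [S.kernel.lookAhead_eq_const S.horizon_pos fun y hy =>
        S.solution.localSpeed_eq_vbar S.horizon_pos S.a_lt_b.le S.vbar_pos S.velocity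
          S.vbar_le_marker_right hs hy]
      have : HasDerivAt (leader b vbar) vbar s :=
        (((hasDerivAt_id s).mul_const vbar).const_add b).congr_deriv (one_mul _)
      exact this.hasDerivWithinAt) ht
  rwa [h0] at this

theorem flow_mem (S : IsRegularSolution a b η vbar W v ρmax ρ₀ ω₀ ρ ω)
    (hX : IsSpeedFlow η T W (localSpeed a b vbar T v ρ ω) X) {t ξ : ℝ} (ht : t ∈ Icc 0 T)
    (hξ : ξ ∈ Icc a b) : X t ξ ∈ Icc a (leader b vbar t) := by
  refine ⟨hξ.1.trans (hX.le_flow S.kernel S.horizon_pos (S.solution.localSpeed_nonneg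
    S.a_lt_b.le S.vbar_pos S.velocity) ht ξ), ?_⟩
  rw [← S.flow_right hX ht]
  exact (hX.strictMono ht).monotone hξ.2

theorem flow_mem_Ioo (S : IsRegularSolution a b η vbar W v ρmax ρ₀ ω₀ ρ ω)
    (hX : IsSpeedFlow η T W (localSpeed a b vbar T v ρ ω) X) {t ξ : ℝ} (ht : t ∈ Icc 0 T)
    (hξ : ξ ∈ Ioo a b) : X t ξ ∈ Ioo a (leader b vbar t) := by
  refine ⟨hξ.1.trans_le (hX.le_flow S.kernel S.horizon_pos (S.solution.localSpeed_nonneg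
    S.a_lt_b.le S.vbar_pos S.velocity) ht ξ), ?_⟩
  rw [← S.flow_right hX ht]
  exact hX.strictMono ht hξ.2

theorem nonlocalVelocity_eq (S : IsRegularSolution a b η vbar W v ρmax ρ₀ ω₀ ρ ω) {t x : ℝ}
    (ht : t ∈ Icc 0 T) (hx : x ∈ Icc a (leader b vbar t)) :
    nonlocalVelocity η W v ρ ω t x = lookAhead η W (localSpeed a b vbar T v ρ ω t) x :=
  S.solution.nonlocalVelocity_eq S.kernel S.horizon_pos S.a_lt_b.le S.vbar_pos S.velocity
    S.vbar_le_marker_right ht hx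

/-- The marker is transported along the flow. -/
theorem marker_flow (S : IsRegularSolution a b η vbar W v ρmax ρ₀ ω₀ ρ ω)
    (hX : IsSpeedFlow η T W (localSpeed a b vbar T v ρ ω) X) {t ξ : ℝ} (ht : t ∈ Icc 0 T)
    (hξ : ξ ∈ Ioc a b) : ω t (X t ξ) = ω₀ ξ := by
  rcases hξ.2.eq_or_lt with rfl | hlt
  · rw [S.flow_right hX ht]
    exact S.solution.marker_right t _ ht.1 le_rfl (by linarith [S.horizon_pos])
  rcases ht.1.eq_or_lt with rfl | h0
  · rw [hX.flow_zero]
    exact S.solution.marker_initial ξ ⟨hξ.1.le, hξ.2⟩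
  have hI : ∀ s ∈ Icc 0 t, s ∈ Icc 0 T := fun s hs => ⟨hs.1, hs.2.trans ht.2⟩
  -- Transport is only assumed for positive times inside the open domain, so the initial time is
  -- reached by a limit; the trajectory of `b` was settled by the leader condition.
  have hconst : ∀ s ∈ Ioc 0 t, ω t (X t ξ) = ω s (X s ξ) := by
    intro s hs
    have hsub : Icc s t ⊆ Icc 0 T := Icc_subset_Icc hs.1.le ht.2
    refine S.solution.marker_eq s t (fun r => X r ξ) hs.1 hs.2
      (fun r hr => S.flow_mem_Ioo hX (hsub hr) ⟨hξ.1, hlt⟩) fun r hr => ?_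
    rw [S.nonlocalVelocity_eq (hsub hr) (S.flow_mem hX (hsub hr) ⟨hξ.1.le, hξ.2⟩)]
    exact (hX.time_deriv ξ r (hsub hr)).mono hsub
  have hc : ContinuousOn (fun s => ω s (X s ξ)) (Icc 0 t) :=
    S.solution.marker_continuous.comp
      (continuous_id.prodMk (continuous_uncurry_right hX.continuous_flow ξ)).continuousOn
      fun s hs => ⟨hs.1, S.flow_mem hX (hI s hs) ⟨hξ.1.le, hξ.2⟩⟩
  have hlim : Tendsto (fun s => ω s (X s ξ)) (𝓝[>] 0) (𝓝 (ω 0 (X 0 ξ))) :=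
    (hc 0 ⟨le_rfl, h0.le⟩).mono_of_mem_nhdsWithin (Icc_mem_nhdsGT h0)
  rw [hX.flow_zero, S.solution.marker_initial ξ ⟨hξ.1.le, hξ.2⟩] at hlim
  refine tendsto_nhds_unique (tendsto_const_nhds.congr' ?_) hlim
  filter_upwards [Ioc_mem_nhdsGT h0] with s hs
  exact hconst s hs

/-- The mass ahead of a trajectory of the flow is conserved. -/
theorem mass_flow (S : IsRegularSolution a b η vbar W v ρmax ρ₀ ω₀ ρ ω)
    (hX : IsSpeedFlow η T W (localSpeed a b vbar T v ρ ω) X) {t ξ : ℝ} (ht : t ∈ Icc 0 T)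
    (hξ : ξ ∈ Icc a b) :
    ∫ y in (X t ξ)..(leader b vbar t), ρ t y = ∫ y in ξ..b, ρ 0 y := by
  obtain ⟨hρ, ρt, hρt, hd⟩ := S.regular.exists_timeDeriv
  -- Negative times are frozen at zero to obtain functions continuous on the whole plane.
  have hc : Continuous fun p : ℝ × ℝ => (max p.1 0, p.2) := by fun_prop
  have hr := hρ.comp_continuous hc fun p => ⟨mem_Ici.2 (le_max_right _ _), mem_univ _⟩
  have hrt := hρt.comp_continuous hc fun p => ⟨mem_Ici.2 (le_max_right _ _), mem_univ _⟩
  have hU : ∀ t, Continuous (lookAhead η W (localSpeed a b vbar T v ρ ω t)) :=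
    continuous_uncurry_left (f := fun t x => lookAhead η W (localSpeed a b vbar T v ρ ω t) x)
      (S.kernel.continuous_lookAhead S.horizon_pos hX.continuous_speed)
  have h := integral_eq_of_conservation (r := fun t x => ρ (max t 0) x)
    (rt := fun t x => ρt (max t 0) x)
    (U := fun t => lookAhead η W (localSpeed a b vbar T v ρ ω t)) (A := fun s => X s ξ)
    (B := fun s => X s b) hr hrt (fun s x hs => by
      rw [max_eq_left hs.le]
      refine (hd s x hs).congr_of_eventuallyEq ?_
      filter_upwards [Ioi_mem_nhds hs] with r hr
      rw [max_eq_left (le_of_lt hr)])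
    (hX.time_deriv ξ) (hX.time_deriv b) (fun s hs => (hX.strictMono hs).monotone hξ.2) hU
    (fun s hs x hx => by
      have hs' := Ioo_subset_Icc_self hs
      have hx1 : a < x := (S.flow_mem hX hs' hξ).1.trans_lt hx.1
      have hx2 : x < leader b vbar s := by
        have := hx.2
        rwa [S.flow_right hX hs'] at this
      rw [max_eq_left hs.1.le, ← (hd s x hs.1).deriv]
      refine (S.solution.density_eq s x hs.1 hx1 hx2).congr_of_eventuallyEq ?_
      filter_upwards [Ioo_mem_nhds hx1 hx2] with y hy
      rw [S.nonlocalVelocity_eq hs' (Ioo_subset_Icc_self hy)]) ht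
  simp only [max_eq_left ht.1, S.flow_right hX ht, hX.flow_zero, max_self] at h
  exact h

/-- Conservation of mass along the flow, in differential form. -/
theorem density_flow (S : IsRegularSolution a b η vbar W v ρmax ρ₀ ω₀ ρ ω)
    (hX : IsSpeedFlow η T W (localSpeed a b vbar T v ρ ω) X) {t ξ : ℝ} (ht : t ∈ Icc 0 T)
    (hξ : ξ ∈ Ioc a b) :
    ρ t (X t ξ) * jacobian η W (localSpeed a b vbar T v ρ ω) X t ξ = ρ₀ ξ := by
  rw [← S.solution.density_initial ξ ⟨hξ.1.le, hξ.2⟩]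
  have hct := S.regular.1 t ht.1
  have hc0 := S.regular.1 0 le_rfl
  have hXt := continuous_uncurry_left hX.continuous_flow t
  have hJ := continuous_uncurry_left
    (f := fun t ξ => jacobian η W (localSpeed a b vbar T v ρ ω) X t ξ)
    (hX.continuous_jacobian S.kernel S.horizon_pos) t
  -- Mass conservation is differentiated in the starting point `ζ`; the endpoint `b` follows by
  -- continuity.
  have hopen : EqOn (fun ζ => ρ t (X t ζ) *
      jacobian η W (localSpeed a b vbar T v ρ ω) X t ζ) (ρ 0) (Ioo a b) := by
    intro ζ hζ
    have h1 : HasDerivAt (fun z => ∫ y in (leader b vbar t)..(X t z), ρ t y)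
        (ρ t (X t ζ) * jacobian η W (localSpeed a b vbar T v ρ ω) X t ζ) ζ :=
      (hasDerivAt_primitive hct (leader b vbar t) (X t ζ)).comp ζ (hX.space_deriv t ht ζ)
    have h2 := hasDerivAt_primitive hc0 b ζ
    refine (h1.congr_of_eventuallyEq ?_).unique h2
    filter_upwards [Ioo_mem_nhds hζ.1 hζ.2] with z hz
    rw [intervalIntegral.integral_symm, ← S.mass_flow hX ht (Ioo_subset_Icc_self hz),
      ← intervalIntegral.integral_symm]
  have hcl := hopen.closure ((hct.comp hXt).mul hJ) hc0
  rw [closure_Ioo S.a_lt_b.ne] at hcl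
  exact hcl ⟨hξ.1.le, hξ.2⟩

theorem density_nonneg (S : IsRegularSolution a b η vbar W v ρmax ρ₀ ω₀ ρ ω) {t x : ℝ}
    (ht : 0 ≤ t) (hx : x ∈ Icc a (leader b vbar t)) : 0 ≤ ρ t x :=
  (S.solution.mem_domain t x ht hx.1 hx.2).2.1

theorem sub_horizon_mem (S : IsRegularSolution a b η vbar W v ρmax ρ₀ ω₀ ρ ω) {t : ℝ}
    (ht : 0 ≤ t) : a < leader b vbar t - η := by
  linarith [S.lt_length, le_leader (b := b) S.vbar_pos ht]

theorem minMass_le (S : IsRegularSolution a b η vbar W v ρmax ρ₀ ω₀ ρ ω) {t : ℝ} (ht : 0 ≤ t) :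
    minMass b η vbar ρ ≤ ∫ x in (leader b vbar t - η)..(leader b vbar t), ρ t x := by
  refine csInf_le ⟨0, ?_⟩ ⟨t, ht, rfl⟩
  rintro _ ⟨s, hs, rfl⟩
  refine intervalIntegral.integral_nonneg (by linarith [S.horizon_pos]) fun x hx => ?_
  exact S.density_nonneg hs ⟨(S.sub_horizon_mem hs).le.trans hx.1, hx.2⟩

/-- The set contains `β(t) - η`, because `c_ρ` is an infimum over all times, and it is closed; so
the supremum is attained. -/
theorem leftBoundary_isGreatest (S : IsRegularSolution a b η vbar W v ρmax ρ₀ ω₀ ρ ω) {t : ℝ}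
    (ht : 0 ≤ t) : IsGreatest {x | leader b vbar t - η ≤ x ∧ x ≤ leader b vbar t ∧
      minMass b η vbar ρ ≤ ∫ y in x..(leader b vbar t), ρ t y} (leftBoundary b η vbar ρ t) := by
  have hbdd : BddAbove {x | leader b vbar t - η ≤ x ∧ x ≤ leader b vbar t ∧
      minMass b η vbar ρ ≤ ∫ y in x..(leader b vbar t), ρ t y} :=
    ⟨leader b vbar t, fun x hx => hx.2.1⟩
  have hc : Continuous fun x => ∫ y in x..(leader b vbar t), ρ t y := by
    simp_rw [intervalIntegral.integral_symm (leader b vbar t)]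
    exact (intervalIntegral.continuous_primitive
      (fun _ _ => (S.regular.1 t ht).intervalIntegrable _ _) _).neg
  have hcl : IsClosed {x | leader b vbar t - η ≤ x ∧ x ≤ leader b vbar t ∧
      minMass b η vbar ρ ≤ ∫ y in x..(leader b vbar t), ρ t y} :=
    (isClosed_le continuous_const continuous_id).inter
      ((isClosed_le continuous_id continuous_const).inter (isClosed_le continuous_const hc))
  exact ⟨hcl.csSup_mem ⟨leader b vbar t - η, le_rfl, by linarith [S.horizon_pos],
    S.minMass_le ht⟩ hbdd, fun x hx => le_csSup hbdd hx⟩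

theorem leftBoundary_zero_mem (S : IsRegularSolution a b η vbar W v ρmax ρ₀ ω₀ ρ ω) :
    leftBoundary b η vbar ρ 0 ∈ Icc (b - η) b := by
  have h := (S.leftBoundary_isGreatest le_rfl).1
  have h0 : leader b vbar 0 = b := by simp [leader]
  rw [h0] at h
  exact ⟨h.1, h.2.1⟩

theorem lt_leftBoundary_zero (S : IsRegularSolution a b η vbar W v ρmax ρ₀ ω₀ ρ ω) :
    a < leftBoundary b η vbar ρ 0 := by
  linarith [S.leftBoundary_zero_mem.1, S.lt_length]

/-- The left boundary moves along the flow. -/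
theorem flow_left (S : IsRegularSolution a b η vbar W v ρmax ρ₀ ω₀ ρ ω)
    (hX : IsSpeedFlow η T W (localSpeed a b vbar T v ρ ω) X) {t : ℝ} (ht : t ∈ Icc 0 T) :
    X t (leftBoundary b η vbar ρ 0) = leftBoundary b η vbar ρ t := by
  set α₀ := leftBoundary b η vbar ρ 0 with hα₀
  have h0 : leader b vbar 0 = b := by simp [leader]
  have hG0 := S.leftBoundary_isGreatest le_rfl
  have hGt := S.leftBoundary_isGreatest ht.1
  rw [h0, ← hα₀] at hG0
  have hmem : α₀ ∈ Icc a b := ⟨S.lt_leftBoundary_zero.le, S.leftBoundary_zero_mem.2⟩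
  -- Otherwise `α(t)` lies on a trajectory that starts to the right of `α₀` with at least the mass
  -- `c_ρ` ahead, against the maximality of `α₀`.
  have hle : leftBoundary b η vbar ρ t ≤ X t α₀ := by
    by_contra! hlt
    have hivt := intermediate_value_Icc hmem.2
      (continuous_uncurry_left hX.continuous_flow t).continuousOn
    rw [S.flow_right hX ht] at hivt
    obtain ⟨ξ, hξ, hξ'⟩ := hivt ⟨hlt.le, hGt.1.2.1⟩
    have hm := S.mass_flow hX ht (ξ := ξ) ⟨hmem.1.trans hξ.1, hξ.2⟩
    have hin := hGt.1.2.2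
    rw [← hξ', hm] at hin
    have := hG0.2 ⟨hG0.1.1.trans hξ.1, hξ.2, hin⟩
    rw [le_antisymm this hξ.1] at hξ'
    exact hlt.ne hξ'
  -- The inequality just proved also keeps `X t α₀` within the horizon `β(t) - η`, so it competes in
  -- the supremum.
  refine le_antisymm (hGt.2 ⟨hGt.1.1.trans hle, (S.flow_mem hX ht hmem).2, ?_⟩) hle
  rw [S.mass_flow hX ht hmem]
  exact hG0.1.2.2

end IsRegularSolution

end

/-! ### Decay of the Lyapunov function in Lagrangian coordinates. -/

section

/-- Decay of `(R - r)² J` along a trajectory with Jacobian `J`, where `R = R₀ / J`. -/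
theorem sq_mul_jacobian_le {J D κ : ℝ → ℝ} {R₀ r μ m T : ℝ}
    (hJ : ∀ t, HasDerivAt J (D t * J t) t) (hJpos : ∀ t, 0 < J t) (hJ0 : J 0 = 1)
    (hR₀ : 0 ≤ R₀) (hr : 0 ≤ r) (hm : m ≤ 0) (hκ : Continuous κ)
    (hκ0 : ∀ t ∈ Icc 0 T, 0 ≤ κ t) (hμ : μ ≤ min R₀ r)
    (key : ∀ t ∈ Icc 0 T, -m * κ t * (R₀ / J t - r) ^ 2 ≤ D t * (R₀ / J t - r)) {t : ℝ}
    (ht : t ∈ Icc 0 T) :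
    (R₀ / J t - r) ^ 2 * J t ≤ (R₀ - r) ^ 2 * Real.exp (2 * m * μ * ∫ s in (0 : ℝ)..t, κ s) := by
  have hT : (0 : ℝ) ≤ T := ht.1.trans ht.2
  set R : ℝ → ℝ := fun s => R₀ / J s with hRdef
  have hR0 : R 0 = R₀ := by simp [hRdef, hJ0]
  have hRn : ∀ s, 0 ≤ R s := fun s => div_nonneg hR₀ (hJpos s).le
  have hRd : ∀ s, HasDerivAt R (-(D s * R s)) s := fun s => by
    refine ((hasDerivAt_const s R₀).div (hJ s) (hJpos s).ne').congr_deriv ?_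
    have := (hJpos s).ne'
    simp only [hRdef]
    field_simp
    ring
  have hRc : Continuous R := continuous_iff_continuousAt.2 fun s => (hRd s).continuousAt
  have hDR : ∀ s ∈ Icc 0 T, 0 ≤ D s * (R s - r) := fun s hs =>
    le_trans (mul_nonneg (mul_nonneg (neg_nonneg.2 hm) (hκ0 s hs)) (sq_nonneg _)) (key s hs)
  have hsqd : ∀ s, HasDerivAt (fun s => (R s - r) ^ 2) (2 * (R s - r) * -(D s * R s)) s :=
    fun s => (((hRd s).sub_const r).pow 2).congr_deriv (by ring)
  -- `D` and `R - r` have nonnegative product, so `R' = -D R` moves `R` towards `r`.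
  have hanti : AntitoneOn (fun s => (R s - r) ^ 2) (Icc 0 T) := by
    refine antitoneOn_of_deriv_nonpos (convex_Icc 0 T)
      (fun s _ => (hsqd s).continuousAt.continuousWithinAt)
      (fun s _ => (hsqd s).differentiableAt.differentiableWithinAt) fun s hs => ?_
    rw [(hsqd s).deriv]
    nlinarith [mul_nonneg (hDR s (interior_subset hs)) (hRn s)]
  -- `R` stays between `R₀` and `r`: once it reached `r`, the nonincreasing square would keep it
  -- there.
  have hmin : ∀ s ∈ Icc 0 T, μ ≤ min (R s) r := by
    intro s hs
    refine hμ.trans (le_min ?_ (min_le_right _ _))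
    have h0 := hanti ⟨le_rfl, hT⟩ hs hs.1
    simp only [hR0] at h0
    rcases le_total R₀ r with h | h
    · rw [min_eq_left h]
      have := abs_le_of_sq_le_sq' (a := R s - r) (b := r - R₀) (by linarith [h0]) (by linarith)
      linarith [this.1]
    · rw [min_eq_right h]
      by_contra! hlt
      obtain ⟨q, hq, hqr⟩ := intermediate_value_Icc' hs.1 hRc.continuousOn
        ⟨hlt.le, hR0.symm ▸ h⟩
      have := hanti ⟨hq.1, hq.2.trans hs.2⟩ hs hq.2
      simp only [hqr, sub_self] at this
      nlinarith [sub_pos.2 hlt]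
  -- The contributions of `R'` and `J'` combine to `-2R + (R - r) = -(R + r)`; the bound `R + r ≥ 2
  -- μ` then produces the rate.
  have hΨd : ∀ s, HasDerivAt
      (fun s => (R s - r) ^ 2 * J s * Real.exp (-(2 * m * μ * ∫ q in (0 : ℝ)..s, κ q)))
      ((-(D s * (R s - r) * (R s + r)) - 2 * m * μ * κ s * (R s - r) ^ 2) *
        (J s * Real.exp (-(2 * m * μ * ∫ q in (0 : ℝ)..s, κ q)))) s := fun s => by
    refine (((hsqd s).mul (hJ s)).mul
      (((hasDerivAt_primitive hκ 0 s).const_mul (2 * m * μ)).neg.exp)).congr_deriv ?_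
    simp only [Pi.neg_apply, Pi.mul_apply]
    ring
  have hΨ : AntitoneOn
      (fun s => (R s - r) ^ 2 * J s * Real.exp (-(2 * m * μ * ∫ q in (0 : ℝ)..s, κ q)))
      (Icc 0 T) := by
    refine antitoneOn_of_deriv_nonpos (convex_Icc 0 T)
      (fun s _ => (hΨd s).continuousAt.continuousWithinAt)
      (fun s _ => (hΨd s).differentiableAt.differentiableWithinAt) fun s hs => ?_
    have hs' := interior_subset hs
    rw [(hΨd s).deriv]
    refine mul_nonpos_of_nonpos_of_nonneg ?_ (mul_nonneg (hJpos s).le (Real.exp_pos _).le)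
    have h1 := mul_le_mul_of_nonneg_right (key s hs') (add_nonneg (hRn s) hr)
    have h2 : 2 * μ ≤ R s + r := by
      linarith [(hmin s hs').trans (min_le_left _ _), (hmin s hs').trans (min_le_right _ _)]
    have h3 := mul_le_mul_of_nonneg_left h2
      (mul_nonneg (mul_nonneg (neg_nonneg.2 hm) (hκ0 s hs')) (sq_nonneg (R s - r)))
    linarith
  have h := hΨ ⟨le_rfl, hT⟩ ht ht.1
  simp only [intervalIntegral.integral_same, mul_zero, neg_zero, Real.exp_zero, mul_one, hJ0,
    hR0] at h
  rw [Real.exp_neg, ← div_eq_mul_inv, div_le_iff₀ (Real.exp_pos _)] at h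
  exact h

variable {a b η vbar T m : ℝ} {W : ℝ → ℝ} {v : ℝ → ℝ → ℝ} {ρmax ρ₀ ω₀ : ℝ → ℝ}
  {ρ ω X : ℝ → ℝ → ℝ}

namespace IsRegularSolution

theorem leader_sub_mem (S : IsRegularSolution a b η vbar W v ρmax ρ₀ ω₀ ρ ω) {t : ℝ}
    (ht : 0 ≤ t) : leader b vbar t - leftBoundary b η vbar ρ t ∈ Icc 0 η := by
  have h := (S.leftBoundary_isGreatest ht).1
  exact ⟨by linarith [h.2.1], by linarith [h.1]⟩

theorem density_flow_eq (S : IsRegularSolution a b η vbar W v ρmax ρ₀ ω₀ ρ ω)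
    (hX : IsSpeedFlow η T W (localSpeed a b vbar T v ρ ω) X) {t ξ : ℝ} (ht : t ∈ Icc 0 T)
    (hξ : ξ ∈ Ioc a b) :
    ρ₀ ξ / jacobian η W (localSpeed a b vbar T v ρ ω) X t ξ = ρ t (X t ξ) := by
  rw [← S.density_flow hX ht hξ, mul_div_cancel_right₀ _ (IsSpeedFlow.jacobian_pos _ _).ne']

/-- Change of variables `x = X t ξ`: both endpoints are trajectories, so the domain becomes
independent of time. -/
theorem lyapunov_eq (S : IsRegularSolution a b η vbar W v ρmax ρ₀ ω₀ ρ ω)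
    (hX : IsSpeedFlow η T W (localSpeed a b vbar T v ρ ω) X) {t : ℝ} (ht : t ∈ Icc 0 T) :
    lyapunov b η vbar v ρmax ρ ω t = ∫ ξ in Ioo (leftBoundary b η vbar ρ 0) b,
      (ρ₀ ξ / jacobian η W (localSpeed a b vbar T v ρ ω) X t ξ -
        eqDensity v ρmax vbar (ω₀ ξ)) ^ 2 *
          jacobian η W (localSpeed a b vbar T v ρ ω) X t ξ := by
  have hmono := hX.strictMono ht
  have himg : X t '' Ioo (leftBoundary b η vbar ρ 0) b =
      Ioo (leftBoundary b η vbar ρ t) (leader b vbar t) := by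
    rw [← S.flow_left hX ht, ← S.flow_right hX ht]
    refine subset_antisymm ?_ (intermediate_value_Ioo S.leftBoundary_zero_mem.2
      (continuous_uncurry_left hX.continuous_flow t).continuousOn)
    rintro _ ⟨ξ, hξ, rfl⟩
    exact ⟨hmono hξ.1, hmono hξ.2⟩
  rw [lyapunov, intervalIntegral.integral_of_le (S.leftBoundary_isGreatest ht.1).1.2.1,
    integral_Ioc_eq_integral_Ioo, ← himg, integral_image_eq_integral_abs_deriv_smul
      measurableSet_Ioo (fun ξ _ => (hX.space_deriv t ht ξ).hasDerivWithinAt) hmono.injective.injOn]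
  refine setIntegral_congr_fun measurableSet_Ioo fun ξ hξ => ?_
  have hξ' : ξ ∈ Ioc a b := ⟨S.lt_leftBoundary_zero.trans hξ.1, hξ.2.le⟩
  simp only [smul_eq_mul]
  rw [abs_of_pos (IsSpeedFlow.jacobian_pos _ _), S.density_flow_eq hX ht hξ',
    S.marker_flow hX ht hξ', mul_comm]

theorem rhoMin_le (S : IsRegularSolution a b η vbar W v ρmax ρ₀ ω₀ ρ ω) {ξ : ℝ}
    (hξ : ξ ∈ Icc (leftBoundary b η vbar ρ 0) b) :
    rhoMin b η vbar v ρmax ρ ω ≤ min (ρ₀ ξ) (eqDensity v ρmax vbar (ω₀ ξ)) := by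
  have hI : ∀ x ∈ Icc (leftBoundary b η vbar ρ 0) b, x ∈ Icc a b := fun x hx =>
    ⟨S.lt_leftBoundary_zero.le.trans hx.1, hx.2⟩
  rw [← S.solution.density_initial ξ (hI ξ hξ), ← S.solution.marker_initial ξ (hI ξ hξ)]
  refine csInf_le ⟨0, ?_⟩ ⟨ξ, hξ, rfl⟩
  rintro _ ⟨x, hx, rfl⟩
  refine le_min (S.density_nonneg le_rfl (by simpa [leader] using hI x hx)) ?_
  rw [S.solution.marker_initial x (hI x hx)]
  exact (S.velocity.eqDensity_spec S.vbar_pos (S.vbar_le_marker x (hI x hx))).1.1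

theorem continuousOn_marker_initial (S : IsRegularSolution a b η vbar W v ρmax ρ₀ ω₀ ρ ω) :
    ContinuousOn ω₀ (Icc a b) := by
  have h : ContinuousOn (fun x => ω 0 x) (Icc a b) :=
    S.solution.marker_continuous.comp (f := fun x : ℝ => ((0 : ℝ), x)) (by fun_prop)
      fun x hx => ⟨le_rfl, hx.1, by simpa [leader] using hx.2⟩
  exact h.congr fun x hx => (S.solution.marker_initial x hx).symm

/-- The Lyapunov function decays as soon as, along the flow, the velocity gradient dominates the
deviation from the equilibrium density. -/
theorem lyapunov_le (S : IsRegularSolution a b η vbar W v ρmax ρ₀ ω₀ ρ ω)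
    (hX : IsSpeedFlow η T W (localSpeed a b vbar T v ρ ω) X) (hm : m < 0)
    (hder : ∀ x ∈ Icc a b, ∀ r ∈ Icc 0 (ρmax (ω₀ x)),
      derivWithin (fun s => v s (ω₀ x)) (Icc 0 (ρmax (ω₀ x))) r ≤ m)
    (key : ∀ t ∈ Icc 0 T, ∀ ξ ∈ Ioo (leftBoundary b η vbar ρ 0) b,
      -m * W (leader b vbar t - leftBoundary b η vbar ρ t) *
          (ρ t (X t ξ) - eqDensity v ρmax vbar (ω₀ ξ)) ^ 2 ≤
        lookAheadDeriv η W (localSpeed a b vbar T v ρ ω t) (X t ξ) *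
          (ρ t (X t ξ) - eqDensity v ρmax vbar (ω₀ ξ))) {t : ℝ} (ht : t ∈ Icc 0 T) :
    lyapunov b η vbar v ρmax ρ ω t ≤ lyapunov b η vbar v ρmax ρ ω 0 *
      Real.exp (2 * m * rhoMin b η vbar v ρmax ρ ω *
        ∫ s in (0 : ℝ)..t, W (leader b vbar s - leftBoundary b η vbar ρ s)) := by
  have hT : (0 : ℝ) ≤ T := ht.1.trans ht.2
  -- A version of `W(β - α)` that is continuous on the whole line and agrees with it on `[0, T]`.
  set κ : ℝ → ℝ := fun s =>
    kernelExt η W (leader b vbar s - X s (leftBoundary b η vbar ρ 0)) with hκ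
  have hκc : Continuous κ := (S.kernel.continuous_ext S.horizon_pos).comp
    (continuous_leader.sub (continuous_uncurry_right hX.continuous_flow _))
  have hκe : ∀ s ∈ Icc 0 T, κ s = W (leader b vbar s - leftBoundary b η vbar ρ s) := by
    intro s hs
    simp only [hκ]
    rw [S.flow_left hX hs, S.kernel.ext_eq S.horizon_pos (S.leader_sub_mem hs.1)]
  have hint : ∫ s in (0 : ℝ)..t, W (leader b vbar s - leftBoundary b η vbar ρ s) =
      ∫ s in (0 : ℝ)..t, κ s := by
    refine intervalIntegral.integral_congr fun s hs => (hκe s ?_).symm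
    rw [uIcc_of_le ht.1] at hs
    exact ⟨hs.1, hs.2.trans ht.2⟩
  have hI : ∀ ξ ∈ Icc (leftBoundary b η vbar ρ 0) b, ξ ∈ Ioc a b := fun ξ hξ =>
    ⟨S.lt_leftBoundary_zero.trans_le hξ.1, hξ.2⟩
  have hI' : ∀ ξ ∈ Icc (leftBoundary b η vbar ρ 0) b, ξ ∈ Icc a b := fun ξ hξ =>
    Ioc_subset_Icc_self (hI ξ hξ)
  rw [hint, S.lyapunov_eq hX ht, S.lyapunov_eq hX ⟨le_rfl, hT⟩, ← integral_mul_const]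
  have heq : ContinuousOn (fun ξ => eqDensity v ρmax vbar (ω₀ ξ))
      (Icc (leftBoundary b η vbar ρ 0) b) := by
    refine ContinuousOn.comp (g := eqDensity v ρmax vbar) (f := ω₀) (t := ω₀ '' Icc a b)
      (S.velocity.continuousOn_eqDensity S.vbar_pos hm ?_)
      (S.continuousOn_marker_initial.mono hI') fun ξ hξ => ⟨ξ, hI' ξ hξ, rfl⟩
    rintro _ ⟨x, hx, rfl⟩
    exact ⟨S.vbar_le_marker x hx, hder x hx⟩
  have hρ₀ : ContinuousOn ρ₀ (Icc (leftBoundary b η vbar ρ 0) b) :=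
    (S.regular.1 0 le_rfl).continuousOn.congr fun ξ hξ =>
      (S.solution.density_initial ξ (hI' ξ hξ)).symm
  -- Only the integrand at time zero has to be shown integrable, which is where continuity of the
  -- equilibrium density in the marker is used.
  refine integral_mono_of_nonneg ?_ ?_ ?_
  · exact Eventually.of_forall fun ξ =>
      mul_nonneg (sq_nonneg _) (IsSpeedFlow.jacobian_pos _ _).le
  · have hc : ContinuousOn (fun ξ => (ρ₀ ξ - eqDensity v ρmax vbar (ω₀ ξ)) ^ 2)
        (Icc (leftBoundary b η vbar ρ 0) b) := (hρ₀.sub heq).pow 2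
    simp only [IsSpeedFlow.jacobian_zero, div_one, mul_one]
    exact (hc.integrableOn_Icc.mono_set Ioo_subset_Icc_self).mul_const _
  · refine (ae_restrict_iff' measurableSet_Ioo).2 (Eventually.of_forall fun ξ hξ => ?_)
    have hξ' := Ioo_subset_Icc_self hξ
    have hξI := hI ξ hξ'
    have hspec := S.velocity.eqDensity_spec S.vbar_pos (S.vbar_le_marker ξ (hI' ξ hξ'))
    simp only [IsSpeedFlow.jacobian_zero, div_one, mul_one]
    refine sq_mul_jacobian_le (T := T) (fun s => hX.hasDerivAt_jacobian S.kernel S.horizon_pos s ξ)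
      (fun s => IsSpeedFlow.jacobian_pos s ξ) (IsSpeedFlow.jacobian_zero ξ) ?_ hspec.1.1 hm.le hκc
      (fun s hs => ?_) (S.rhoMin_le hξ') (fun s hs => ?_) ht
    · rw [← S.solution.density_initial ξ (hI' ξ hξ')]
      exact S.density_nonneg le_rfl (by simpa [leader] using hI' ξ hξ')
    · rw [hκe s hs]
      exact S.kernel.nonneg _ (S.leader_sub_mem hs.1)
    · rw [hκe s hs, S.density_flow_eq hX hs hξI]
      exact key s hs ξ hξ

end IsRegularSolution

end

/-! ### The velocity gradient dominates the deviation from equilibrium. -/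

section

variable {a b η vbar T m : ℝ} {W : ℝ → ℝ} {v : ℝ → ℝ → ℝ} {ρmax ρ₀ ω₀ : ℝ → ℝ}
  {ρ ω X : ℝ → ℝ → ℝ}

theorem kernelSlope_eq_zero_of_const {c : ℝ} (hη : 0 < η) (hc : ∀ x ∈ Icc 0 η, W x = c) (z : ℝ) :
    kernelSlope η W z = 0 := by
  have hz : max 0 (min z η) ∈ Icc 0 η := ⟨le_max_left _ _, max_le hη.le (min_le_right _ _)⟩
  rw [kernelSlope, derivWithin_congr (f := fun _ => c) (fun x hx => hc x hx) (hc _ hz)]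
  simp

theorem nonneg_of_hasDerivAt_of_le_left {g : ℝ → ℝ} {g' s t : ℝ} (hst : s < t)
    (hg : HasDerivAt g g' t) (hle : ∀ q ∈ Icc s t, g q ≤ g t) : 0 ≤ g' := by
  have h := (hasDerivAt_iff_tendsto_slope.1 hg).mono_left
    (nhdsWithin_mono t (s := Iio t) fun q hq => (mem_Iio.1 hq).ne)
  refine ge_of_tendsto h ?_
  filter_upwards [Ioo_mem_nhdsLT hst] with q hq
  rw [slope_def_field]
  exact div_nonneg_of_nonpos (by linarith [hle q ⟨hq.1.le, hq.2.le⟩]) (by linarith [hq.2])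

namespace IsVelocity

/-- The sign `σ` treats both monotone cases at once: `σ = 1` for nonincreasing and `σ = -1` for
nondecreasing densities. -/
theorem sign_sub_nonneg (hv : IsVelocity v ρmax) {w σ : ℝ} (hw : 0 < w) (hm : m ≤ 0)
    (hd : ∀ r ∈ Icc 0 (ρmax w), derivWithin (fun s => v s w) (Icc 0 (ρmax w)) r ≤ m)
    (hσ : σ = 1 ∨ σ = -1) {r s : ℝ} (hr : r ∈ Icc 0 (ρmax w)) (hs : s ∈ Icc 0 (ρmax w))
    (h : 0 ≤ σ * (s - r)) : 0 ≤ σ * (v r w - v s w) := by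
  rcases hσ with rfl | rfl
  · have h1 := hv.sub_le hw hd hr hs (by linarith)
    nlinarith
  · have h1 := hv.sub_le hw hd hs hr (by linarith)
    nlinarith

/-- A one-sided Lipschitz bound: when `σ * (s - r)` is negative, so is the left side up to equality,
and only an upper bound on `σ * (s - r)` is needed. -/
theorem sign_sub_le (hv : IsVelocity v ρmax) {w σ Λ D : ℝ} (hw : 0 < w) (hm : m ≤ 0)
    (hd : ∀ r ∈ Icc 0 (ρmax w), derivWithin (fun s => v s w) (Icc 0 (ρmax w)) r ≤ m)
    (hσ : σ = 1 ∨ σ = -1) (hΛ0 : 0 ≤ Λ)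
    (hΛ : ∀ r ∈ Icc 0 (ρmax w), ∀ s ∈ Icc 0 (ρmax w), |v r w - v s w| ≤ Λ * |r - s|) {r s : ℝ}
    (hr : r ∈ Icc 0 (ρmax w)) (hs : s ∈ Icc 0 (ρmax w)) (hD : 0 ≤ D) (h : σ * (s - r) ≤ D) :
    σ * (v r w - v s w) ≤ Λ * D := by
  rcases le_total 0 (σ * (s - r)) with h0 | h0
  · have hσ1 : |σ| = 1 := by rcases hσ with rfl | rfl <;> simp
    have h1 : |r - s| = σ * (s - r) := by
      rw [← abs_of_nonneg h0, abs_mul, hσ1, one_mul, abs_sub_comm]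
    calc σ * (v r w - v s w) ≤ |σ * (v r w - v s w)| := le_abs_self _
      _ = |v r w - v s w| := by rw [abs_mul, hσ1, one_mul]
      _ ≤ Λ * |r - s| := hΛ r hr s hs
      _ ≤ Λ * D := by rw [h1]; exact mul_le_mul_of_nonneg_left h hΛ0
  · have h1 := hv.sign_sub_nonneg hw hm hd hσ hs hr (by linarith)
    nlinarith [mul_nonneg hΛ0 hD]

end IsVelocity

namespace IsRegularSolution

theorem localSpeed_horizon (S : IsRegularSolution a b η vbar W v ρmax ρ₀ ω₀ ρ ω)
    (hX : IsSpeedFlow η T W (localSpeed a b vbar T v ρ ω) X) {t ξ : ℝ} (ht : t ∈ Icc 0 T)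
    (hξ : leftBoundary b η vbar ρ 0 ≤ ξ) {y : ℝ} (hy : X t ξ + η ≤ y) :
    localSpeed a b vbar T v ρ ω t y = vbar := by
  refine S.solution.localSpeed_eq_vbar S.horizon_pos S.a_lt_b.le S.vbar_pos S.velocity
    S.vbar_le_marker_right ht ?_
  have h1 := (hX.strictMono ht).monotone hξ
  rw [S.flow_left hX ht] at h1
  linarith [(S.leftBoundary_isGreatest ht.1).1.1]

theorem localSpeed_flow (S : IsRegularSolution a b η vbar W v ρmax ρ₀ ω₀ ρ ω)
    (hX : IsSpeedFlow η T W (localSpeed a b vbar T v ρ ω) X) {t ξ : ℝ} (ht : t ∈ Icc 0 T)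
    (hξ : ξ ∈ Ioc a b) : localSpeed a b vbar T v ρ ω t (X t ξ) = v (ρ t (X t ξ)) (ω₀ ξ) := by
  rw [localSpeed_eq ht (S.flow_mem hX ht (Ioc_subset_Icc_self hξ)), S.marker_flow hX ht hξ]

theorem density_flow_mem (S : IsRegularSolution a b η vbar W v ρmax ρ₀ ω₀ ρ ω)
    (hX : IsSpeedFlow η T W (localSpeed a b vbar T v ρ ω) X) {t ξ : ℝ} (ht : t ∈ Icc 0 T)
    (hξ : ξ ∈ Ioc a b) : ρ t (X t ξ) ∈ Icc 0 (ρmax (ω₀ ξ)) := by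
  have h := S.flow_mem hX ht (Ioc_subset_Icc_self hξ)
  have := (S.solution.mem_domain t _ ht.1 h.1 h.2).2
  rwa [S.marker_flow hX ht hξ] at this

/-- With `W' = 0` the gradient is the local quantity `c (v̄ - v(ρ, ω₀ ξ))`, and strong monotonicity
between `ρ` and the equilibrium density concludes. -/
theorem velocity_gradient_of_const (S : IsRegularSolution a b η vbar W v ρmax ρ₀ ω₀ ρ ω)
    (hX : IsSpeedFlow η T W (localSpeed a b vbar T v ρ ω) X)
    (hder : ∀ x ∈ Icc a b, ∀ r ∈ Icc 0 (ρmax (ω₀ x)),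
      derivWithin (fun s => v s (ω₀ x)) (Icc 0 (ρmax (ω₀ x))) r ≤ m)
    {c : ℝ} (hc : ∀ x ∈ Icc 0 η, W x = c) {t ξ : ℝ} (ht : t ∈ Icc 0 T)
    (hξ : ξ ∈ Ioo (leftBoundary b η vbar ρ 0) b) :
    -m * W (leader b vbar t - leftBoundary b η vbar ρ t) *
        (ρ t (X t ξ) - eqDensity v ρmax vbar (ω₀ ξ)) ^ 2 ≤
      lookAheadDeriv η W (localSpeed a b vbar T v ρ ω t) (X t ξ) *
        (ρ t (X t ξ) - eqDensity v ρmax vbar (ω₀ ξ)) := by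
  have hξI : ξ ∈ Ioc a b := ⟨S.lt_leftBoundary_zero.trans hξ.1, hξ.2.le⟩
  have hξI' := Ioc_subset_Icc_self hξI
  have h0 : (0 : ℝ) ∈ Icc 0 η := ⟨le_rfl, S.horizon_pos.le⟩
  obtain ⟨hr, hvr⟩ := S.velocity.eqDensity_spec S.vbar_pos (S.vbar_le_marker ξ hξI')
  rw [S.kernel.lookAheadDeriv_eq S.horizon_pos
    (continuous_uncurry_left hX.continuous_speed t) (S.localSpeed_horizon hX ht hξ.1.le le_rfl),
    S.localSpeed_flow hX ht hξI]
  simp only [kernelSlope_eq_zero_of_const S.horizon_pos hc, zero_mul,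
    intervalIntegral.integral_zero, sub_zero]
  rw [hc _ (S.leader_sub_mem ht.1), hc 0 h0]
  have hc0 : 0 ≤ c := hc 0 h0 ▸ S.kernel.nonneg 0 h0
  have key := mul_le_mul_of_nonneg_left (S.velocity.sub_mul_sub_ge
    (S.vbar_pos.trans_le (S.vbar_le_marker ξ hξI')) (hder ξ hξI') hr
    (S.density_flow_mem hX ht hξI)) hc0
  rw [hvr] at key
  linarith

/-- Monotonicity in space of the density behind the leader is preserved in time if the marker is
constant there. -/
theorem density_flow_monotone (S : IsRegularSolution a b η vbar W v ρmax ρ₀ ω₀ ρ ω)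
    (hX : IsSpeedFlow η T W (localSpeed a b vbar T v ρ ω) X) (hm : m ≤ 0)
    (hder : ∀ x ∈ Icc a b, ∀ r ∈ Icc 0 (ρmax (ω₀ x)),
      derivWithin (fun s => v s (ω₀ x)) (Icc 0 (ρmax (ω₀ x))) r ≤ m)
    {w σ : ℝ} (hσ : σ = 1 ∨ σ = -1) (hw : ∀ x ∈ Icc (b - η) b, ω₀ x = w)
    (hρ₀ : ∀ x ∈ Icc (b - η) b, ∀ y ∈ Icc (b - η) b, x ≤ y → σ * (ρ₀ y - ρ₀ x) ≤ 0)
    {t ξ ζ : ℝ} (ht : t ∈ Icc 0 T) (hξ : leftBoundary b η vbar ρ 0 ≤ ξ) (hξζ : ξ ≤ ζ)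
    (hζ : ζ ≤ b) : σ * (ρ t (X t ζ) - ρ t (X t ξ)) ≤ 0 := by
  have hT : (0 : ℝ) ≤ T := ht.1.trans ht.2
  have hη := S.horizon_pos
  set α₀ := leftBoundary b η vbar ρ 0 with hα₀
  set h := localSpeed a b vbar T v ρ ω with hh
  have hαb : b - η ≤ α₀ := S.leftBoundary_zero_mem.1
  have hI : ∀ x, α₀ ≤ x → x ≤ b → x ∈ Ioc a b := fun x h1 h2 =>
    ⟨S.lt_leftBoundary_zero.trans_le h1, h2⟩
  have hdf : ∀ s ∈ Icc 0 T, ∀ x, α₀ ≤ x → x ≤ b →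
      ρ₀ x / jacobian η W h X s x = ρ s (X s x) := fun s hs x h1 h2 =>
    S.density_flow_eq hX hs (hI x h1 h2)
  have hwI : ∀ x, α₀ ≤ x → x ≤ b → ω₀ x = w := fun x h1 h2 => hw x ⟨hαb.trans h1, h2⟩
  have hwb : ω₀ b = w := hw b ⟨by linarith, le_rfl⟩
  have hw0 : 0 < w := hwb ▸ S.vbar_pos.trans_le S.vbar_le_marker_right
  have hd : ∀ r ∈ Icc 0 (ρmax w), derivWithin (fun s => v s w) (Icc 0 (ρmax w)) r ≤ m :=
    hwb ▸ hder b ⟨S.a_lt_b.le, le_rfl⟩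
  obtain ⟨Λ, hΛ0, hΛ⟩ := S.velocity.exists_sub_le hw0
  obtain ⟨k, hk0, hk⟩ := S.kernel.exists_slope_bound hη
  obtain ⟨M, hM⟩ := S.solution.exists_localSpeed_bound S.a_lt_b.le S.vbar_pos hT S.velocity
    S.regular.exists_timeDeriv.1
  obtain ⟨K, hK⟩ := S.kernel.exists_lookAheadDeriv_bound hη M
  have hP : 0 < ρmax w := S.velocity.rhoMax_pos w hw0
  have hK0 : 0 ≤ K := (abs_nonneg _).trans (hK (h 0) (hM 0) 0)
  -- `C - 1` bounds the growth rate of the largest monotonicity defect: `K` comes from `∂ₓV`, the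
  -- other term from the nonlocal difference of gradients.
  set C : ℝ := K + ρmax w * (k * (Λ * η)) + 1 with hC
  have hCpos : 0 < C := by positivity
  -- Maximum principle: the defect over ordered pairs, damped by `exp(-2Ct)`, attains its maximum.
  -- At a positive maximum the growth rate would have to be at least `2C`, contradicting the bound
  -- `C - 1`.
  set F : ℝ × ℝ × ℝ → ℝ := fun p =>
    Real.exp (-(2 * C * p.1)) * (σ * (ρ p.1 (X p.1 p.2.2) - ρ p.1 (X p.1 p.2.1))) with hF
  set Q : Set (ℝ × ℝ × ℝ) := (Icc 0 T ×ˢ (Icc α₀ b ×ˢ Icc α₀ b)) ∩ {p | p.2.1 ≤ p.2.2} with hQ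
  have hQc : IsCompact Q := (isCompact_Icc.prod (isCompact_Icc.prod isCompact_Icc)).inter_right
    (isClosed_le (by fun_prop) (by fun_prop))
  have hFc : ContinuousOn F Q := by
    have e : ∀ π : ℝ × ℝ × ℝ → ℝ, Continuous π →
        ContinuousOn (fun p : ℝ × ℝ × ℝ => ρ p.1 (X p.1 (π p))) Q := fun π hπ =>
      S.regular.exists_timeDeriv.1.comp
        (continuous_fst.prodMk (hX.continuous_flow.comp (continuous_fst.prodMk hπ))).continuousOn
        fun p hp => ⟨hp.1.1.1, mem_univ _⟩
    exact (by fun_prop : Continuous fun p : ℝ × ℝ × ℝ => Real.exp (-(2 * C * p.1))).continuousOn.mul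
      (continuousOn_const.mul ((e _ (by fun_prop)).sub (e _ (by fun_prop))))
  obtain ⟨⟨τ, x₁, x₂⟩, hp, hmax⟩ := hQc.exists_isMaxOn
    ⟨(t, ξ, ζ), ⟨ht, ⟨hξ, hξζ.trans hζ⟩, hξ.trans hξζ, hζ⟩, hξζ⟩ hFc
  obtain ⟨⟨hτ, hx₁, hx₂⟩, hx₁₂⟩ := hp
  simp only at hτ hx₁ hx₂
  simp only [mem_ofPred_eq] at hx₁₂
  set D : ℝ := σ * (ρ τ (X τ x₂) - ρ τ (X τ x₁)) with hD
  suffices hD0 : D ≤ 0 by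
    have h1 := hmax (show (t, ξ, ζ) ∈ Q from
      ⟨⟨ht, ⟨hξ, hξζ.trans hζ⟩, hξ.trans hξζ, hζ⟩, hξζ⟩)
    simp only [hF, mem_ofPred_eq, ← hD] at h1
    have h2 := h1.trans (mul_nonpos_of_nonneg_of_nonpos (Real.exp_pos _).le hD0)
    exact nonpos_of_mul_nonpos_right h2 (Real.exp_pos _)
  by_contra! hDpos
  have hmaxτ : ∀ y z, α₀ ≤ y → y ≤ z → z ≤ b → σ * (ρ τ (X τ z) - ρ τ (X τ y)) ≤ D := by
    intro y z h1 h2 h3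
    have h := hmax (show (τ, y, z) ∈ Q from ⟨⟨hτ, ⟨h1, h2.trans h3⟩, h1.trans h2, h3⟩, h2⟩)
    exact le_of_mul_le_mul_left h (Real.exp_pos _)
  have hτ0 : 0 < τ := by
    refine lt_of_le_of_ne hτ.1 fun h0 => ?_
    rw [hD, ← h0, hX.flow_zero, hX.flow_zero,
      S.solution.density_initial _ (Ioc_subset_Icc_self (hI _ hx₁.1 hx₁.2)),
      S.solution.density_initial _ (Ioc_subset_Icc_self (hI _ hx₂.1 hx₂.2))] at hDpos
    linarith [hρ₀ x₁ ⟨hαb.trans hx₁.1, hx₁.2⟩ x₂ ⟨hαb.trans hx₂.1, hx₂.2⟩ hx₁₂]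
  set V₁ := lookAheadDeriv η W (h τ) (X τ x₁) with hV₁
  set V₂ := lookAheadDeriv η W (h τ) (X τ x₂) with hV₂
  -- Along a trajectory the density is `ρ₀ / J`, so its time derivative needs no spatial derivative
  -- of `ρ`.
  have hRd : ∀ x, α₀ ≤ x → x ≤ b → HasDerivAt (fun s => ρ₀ x / jacobian η W h X s x)
      (-(lookAheadDeriv η W (h τ) (X τ x) * ρ τ (X τ x))) τ := by
    intro x h1 h2
    have hJ := (IsSpeedFlow.jacobian_pos (η := η) (W := W) (h := h) (X := X) τ x).ne'
    refine ((hasDerivAt_const τ (ρ₀ x)).div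
      (hX.hasDerivAt_jacobian S.kernel hη τ x) hJ).congr_deriv ?_
    rw [← hdf τ hτ x h1 h2]
    field_simp
    ring
  have hgd := ((((hasDerivAt_id τ).const_mul (2 * C)).neg.exp)).mul
    (((hRd x₂ hx₂.1 hx₂.2).sub (hRd x₁ hx₁.1 hx₁.2)).const_mul σ)
  have hge := nonneg_of_hasDerivAt_of_le_left hτ0 hgd fun s hs => by
    have hs' : s ∈ Icc 0 T := ⟨hs.1, hs.2.trans hτ.2⟩
    have h1 := hmax (show (s, x₁, x₂) ∈ Q from ⟨⟨hs', hx₁, hx₂⟩, hx₁₂⟩)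
    simp only [hF, mem_ofPred_eq] at h1
    simp only [Pi.mul_apply, Pi.sub_apply, Pi.neg_apply, id,
      hdf s hs' x₁ hx₁.1 hx₁.2, hdf s hs' x₂ hx₂.1 hx₂.2,
      hdf τ hτ x₁ hx₁.1 hx₁.2, hdf τ hτ x₂ hx₂.1 hx₂.2]
    exact h1
  simp only [Pi.sub_apply, Pi.neg_apply, id, hdf τ hτ x₁ hx₁.1 hx₁.2,
    hdf τ hτ x₂ hx₂.1 hx₂.2] at hge
  have hle : σ * (-(V₂ * ρ τ (X τ x₂)) - -(V₁ * ρ τ (X τ x₁))) ≤ (C - 1) * D := by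
    have hmem : ∀ y, α₀ ≤ y → y ≤ b → ρ τ (X τ y) ∈ Icc 0 (ρmax w) := fun y h1 h2 =>
      hwI y h1 h2 ▸ S.density_flow_mem hX hτ (hI y h1 h2)
    have hspeed : ∀ y, α₀ ≤ y → y ≤ b → h τ (X τ y) = v (ρ τ (X τ y)) w := fun y h1 h2 => by
      rw [hh, S.localSpeed_flow hX hτ (hI y h1 h2), hwI y h1 h2]
    -- Points past the leader have the leader's speed, so they may be replaced by the leader; the
    -- order of two look-ahead points survives, and the maximal defect bounds their densities.
    have hclamp : ∀ y, X τ α₀ ≤ y → ∃ z, α₀ ≤ z ∧ z ≤ b ∧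
        X τ z = min y (leader b vbar τ) ∧ h τ y = h τ (X τ z) := by
      intro y hy
      have hivt := intermediate_value_Icc S.leftBoundary_zero_mem.2
        (continuous_uncurry_left hX.continuous_flow τ).continuousOn
      have hle : X τ α₀ ≤ leader b vbar τ := by
        rw [← S.flow_right hX hτ]
        exact (hX.strictMono hτ).monotone S.leftBoundary_zero_mem.2
      obtain ⟨z, hz, hz'⟩ := hivt ⟨le_min hy hle,
        (min_le_right _ _).trans (S.flow_right hX hτ).ge⟩
      refine ⟨z, hz.1, hz.2, hz', ?_⟩
      rw [hz']
      rcases le_total y (leader b vbar τ) with h1 | h1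
      · rw [min_eq_left h1]
      · have e := fun y hy => S.solution.localSpeed_eq_vbar hη S.a_lt_b.le S.vbar_pos S.velocity
          S.vbar_le_marker_right hτ (y := y) hy
        rw [min_eq_right h1, hh, e y h1, e _ le_rfl]
    have hX₁ := (hX.strictMono hτ).monotone hx₁.1
    have hX₁₂ := (hX.strictMono hτ).monotone hx₁₂
    have hpt : ∀ z ∈ Icc 0 η, σ * (h τ (X τ x₁ + z) - h τ (X τ x₂ + z)) ≤ Λ * D := by
      intro z hz
      obtain ⟨y₁, l₁, u₁, e₁, f₁⟩ := hclamp (X τ x₁ + z) (by linarith [hz.1])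
      obtain ⟨y₂, l₂, u₂, e₂, f₂⟩ := hclamp (X τ x₂ + z) (by linarith [hz.1])
      have hy : y₁ ≤ y₂ := by
        rw [← (hX.strictMono hτ).le_iff_le, e₁, e₂]
        exact min_le_min_right _ (by linarith)
      rw [f₁, f₂, hspeed y₁ l₁ u₁, hspeed y₂ l₂ u₂]
      exact S.velocity.sign_sub_le hw0 hm hd hσ hΛ0 hΛ (hmem y₁ l₁ u₁) (hmem y₂ l₂ u₂) hDpos.le
        (hmaxτ y₁ y₂ l₁ hy u₂)
    -- The local term of the gradient difference has the favourable sign, so `W 0` does not enter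
    -- the growth rate.
    have h0 : 0 ≤ σ * (h τ (X τ x₁) - h τ (X τ x₂)) := by
      rw [hspeed x₁ hx₁.1 hx₁.2, hspeed x₂ hx₂.1 hx₂.2]
      exact S.velocity.sign_sub_nonneg hw0 hm hd hσ (hmem _ hx₁.1 hx₁.2) (hmem _ hx₂.1 hx₂.2)
        hDpos.le
    have hcont := continuous_uncurry_left hX.continuous_speed τ
    have hkc := S.kernel.continuous_slope hη
    have hi : ∀ x : ℝ, IntervalIntegrable (fun z => kernelSlope η W z * (h τ (x + z) - vbar))
        volume 0 η := fun x => Continuous.intervalIntegrable (by fun_prop) _ _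
    have hVdiff : σ * (V₁ - V₂) = -(W 0 * (σ * (h τ (X τ x₁) - h τ (X τ x₂)))) +
        ∫ z in (0 : ℝ)..η, -kernelSlope η W z *
          (σ * (h τ (X τ x₁ + z) - h τ (X τ x₂ + z))) := by
      have e : ∀ z, -kernelSlope η W z * (σ * (h τ (X τ x₁ + z) - h τ (X τ x₂ + z))) =
          -σ * (kernelSlope η W z * (h τ (X τ x₁ + z) - vbar) -
            kernelSlope η W z * (h τ (X τ x₂ + z) - vbar)) := fun z => by ring
      simp_rw [e]
      rw [intervalIntegral.integral_const_mul, intervalIntegral.integral_sub (hi _) (hi _), hV₁,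
        hV₂, S.kernel.lookAheadDeriv_eq hη hcont (S.localSpeed_horizon hX hτ hx₁.1 le_rfl),
        S.kernel.lookAheadDeriv_eq hη hcont (S.localSpeed_horizon hX hτ hx₂.1 le_rfl)]
      ring
    have hint : ∫ z in (0 : ℝ)..η, -kernelSlope η W z *
        (σ * (h τ (X τ x₁ + z) - h τ (X τ x₂ + z))) ≤ k * (Λ * D) * η := by
      have h1 := intervalIntegral.integral_mono_on (μ := volume) hη.le
        (f := fun z => -kernelSlope η W z * (σ * (h τ (X τ x₁ + z) - h τ (X τ x₂ + z))))
        (g := fun _ => k * (Λ * D)) (Continuous.intervalIntegrable (by fun_prop) _ _)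
        (by simp) fun z hz => by
          have hkz := S.kernel.slope_nonpos hη z
          have hkz' : -kernelSlope η W z ≤ k := (neg_le_abs _).trans (hk z hz)
          exact (mul_le_mul_of_nonneg_left (hpt z hz) (by linarith)).trans
            (mul_le_mul_of_nonneg_right hkz' (mul_nonneg hΛ0 hDpos.le))
      rw [intervalIntegral.integral_const, smul_eq_mul, sub_zero, mul_comm] at h1
      exact h1
    have hW0 : 0 ≤ W 0 := S.kernel.nonneg 0 ⟨le_rfl, hη.le⟩
    have hVle : σ * (V₁ - V₂) ≤ k * (Λ * D) * η := by
      rw [hVdiff]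
      linarith [mul_nonneg hW0 h0]
    have hR₁ := hmem x₁ hx₁.1 hx₁.2
    have hE0 : 0 ≤ k * (Λ * D) * η := by positivity
    have a1 : ρ τ (X τ x₁) * (σ * (V₁ - V₂)) ≤ ρmax w * (k * (Λ * D) * η) :=
      (mul_le_mul_of_nonneg_left hVle hR₁.1).trans (mul_le_mul_of_nonneg_right hR₁.2 hE0)
    have a2 : -V₂ * D ≤ K * D :=
      mul_le_mul_of_nonneg_right ((neg_le_abs _).trans (hK (h τ) (hM τ) _)) hDpos.le
    have a3 : σ * (-(V₂ * ρ τ (X τ x₂)) - -(V₁ * ρ τ (X τ x₁))) =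
        -V₂ * D + ρ τ (X τ x₁) * (σ * (V₁ - V₂)) := by rw [hD]; ring
    rw [a3, hC]
    linarith
  have hexp := Real.exp_pos (-(2 * C * τ))
  have hfin : Real.exp (-(2 * C * τ)) * (2 * C * D) ≤ Real.exp (-(2 * C * τ)) * ((C - 1) * D) := by
    have := mul_le_mul_of_nonneg_left hle hexp.le
    rw [hD] at this ⊢
    linarith
  have := le_of_mul_le_mul_left hfin hexp
  nlinarith [mul_pos hCpos hDpos]

/-- The density tends monotonically to its value at the leader, so `G = σ (v̄ - v)` is nonnegative
at `x` and no larger further ahead. Since `W' ≤ 0`, replacing `G (x + z)` by `G x` under the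
integral only lowers it, and `W 0 + ∫ W'` up to the leader is `W(β - x)`. -/
theorem velocity_gradient_of_monotone (S : IsRegularSolution a b η vbar W v ρmax ρ₀ ω₀ ρ ω)
    (hX : IsSpeedFlow η T W (localSpeed a b vbar T v ρ ω) X) (hm : m ≤ 0)
    (hder : ∀ x ∈ Icc a b, ∀ r ∈ Icc 0 (ρmax (ω₀ x)),
      derivWithin (fun s => v s (ω₀ x)) (Icc 0 (ρmax (ω₀ x))) r ≤ m)
    {w σ : ℝ} (hσ : σ = 1 ∨ σ = -1) (hw : ∀ x ∈ Icc (b - η) b, ω₀ x = w)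
    (hρ₀ : ∀ x ∈ Icc (b - η) b, ∀ y ∈ Icc (b - η) b, x ≤ y → σ * (ρ₀ y - ρ₀ x) ≤ 0)
    {t ξ : ℝ} (ht : t ∈ Icc 0 T) (hξ : ξ ∈ Ioo (leftBoundary b η vbar ρ 0) b) :
    -m * W (leader b vbar t - leftBoundary b η vbar ρ t) *
        (ρ t (X t ξ) - eqDensity v ρmax vbar (ω₀ ξ)) ^ 2 ≤
      lookAheadDeriv η W (localSpeed a b vbar T v ρ ω t) (X t ξ) *
        (ρ t (X t ξ) - eqDensity v ρmax vbar (ω₀ ξ)) := by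
  have hη := S.horizon_pos
  have hαb : b - η ≤ leftBoundary b η vbar ρ 0 := S.leftBoundary_zero_mem.1
  have hI : ∀ x, leftBoundary b η vbar ρ 0 ≤ x → x ≤ b → x ∈ Ioc a b := fun x h1 h2 =>
    ⟨S.lt_leftBoundary_zero.trans_le h1, h2⟩
  have hwI : ∀ x, leftBoundary b η vbar ρ 0 ≤ x → x ≤ b → ω₀ x = w :=
    fun x h1 h2 => hw x ⟨hαb.trans h1, h2⟩
  have hwb : ω₀ b = w := hw b ⟨by linarith, le_rfl⟩
  have hwv : vbar ≤ w := hwb ▸ S.vbar_le_marker_right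
  have hw0 : 0 < w := S.vbar_pos.trans_le hwv
  have hd : ∀ r ∈ Icc 0 (ρmax w), derivWithin (fun s => v s w) (Icc 0 (ρmax w)) r ≤ m :=
    hwb ▸ hder b ⟨S.a_lt_b.le, le_rfl⟩
  obtain ⟨hr, hvr⟩ := S.velocity.eqDensity_spec S.vbar_pos hwv
  rw [hwI ξ hξ.1.le hξ.2.le]
  set r := eqDensity v ρmax vbar w with hrdef
  set h := localSpeed a b vbar T v ρ ω with hh
  set x := X t ξ with hx
  have hmono := fun y z h1 h2 h3 => S.density_flow_monotone hX hm hder hσ hw hρ₀ ht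
    (ξ := y) (ζ := z) h1 h2 h3
  have hmem : ∀ y, leftBoundary b η vbar ρ 0 ≤ y → y ≤ b → ρ t (X t y) ∈ Icc 0 (ρmax w) :=
    fun y h1 h2 => hwI y h1 h2 ▸ S.density_flow_mem hX ht (hI y h1 h2)
  have hspeed : ∀ y, leftBoundary b η vbar ρ 0 ≤ y → y ≤ b → h t (X t y) = v (ρ t (X t y)) w :=
    fun y h1 h2 => by rw [hh, S.localSpeed_flow hX ht (hI y h1 h2), hwI y h1 h2]
  have hright : ρ t (X t b) = r := by
    rw [S.flow_right hX ht, S.solution.density_right t _ ht.1 le_rfl (by linarith), hwb]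
  have hfront : ∀ y, leader b vbar t ≤ y → h t y = vbar := fun y hy =>
    S.solution.localSpeed_eq_vbar hη S.a_lt_b.le S.vbar_pos S.velocity S.vbar_le_marker_right ht hy
  have hρr : 0 ≤ σ * (ρ t x - r) := by
    have := hmono ξ b hξ.1.le hξ.2.le le_rfl
    rw [hright] at this
    linarith
  set G : ℝ → ℝ := fun y => σ * (vbar - h t y) with hG
  have hGx : 0 ≤ G x := by
    have := S.velocity.sign_sub_nonneg hw0 hm hd hσ hr (hmem ξ hξ.1.le hξ.2.le) hρr
    rw [hvr] at this
    simp only [hG, hx, hspeed ξ hξ.1.le hξ.2.le]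
    exact this
  have hxl : x < leader b vbar t := by
    rw [← S.flow_right hX ht]
    exact hX.strictMono ht hξ.2
  have hxα : leftBoundary b η vbar ρ t ≤ x := by
    rw [← S.flow_left hX ht]
    exact (hX.strictMono ht).monotone hξ.1.le
  have hGle : ∀ z, 0 ≤ z → G (x + z) ≤ G x := by
    intro z hz
    rcases le_total (leader b vbar t) (x + z) with h1 | h1
    · simp only [hG] at hGx ⊢
      rw [hfront _ h1, sub_self, mul_zero]
      exact hGx
    · obtain ⟨y, hy, hy'⟩ := intermediate_value_Icc hξ.2.le
        (continuous_uncurry_left hX.continuous_flow t).continuousOn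
        ⟨by linarith, h1.trans (S.flow_right hX ht).ge⟩
      have hyα := hξ.1.le.trans hy.1
      have h2 := S.velocity.sign_sub_nonneg hw0 hm hd hσ (hmem y hyα hy.2)
        (hmem ξ hξ.1.le hξ.2.le) (by linarith [hmono ξ y hξ.1.le hy.1 hy.2])
      simp only [hG]
      rw [← hy', hspeed y hyα hy.2, hx, hspeed ξ hξ.1.le hξ.2.le]
      linarith
  have hcont := continuous_uncurry_left hX.continuous_speed t
  have hkc := S.kernel.continuous_slope hη
  have hGc : Continuous G := continuous_const.mul (continuous_const.sub hcont)
  have hlη : leader b vbar t - x ≤ η := by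
    linarith [(S.leftBoundary_isGreatest ht.1).1.1]
  have hl0 : 0 ≤ leader b vbar t - x := by linarith
  have hV : σ * lookAheadDeriv η W (h t) x =
      W 0 * G x + ∫ z in (0 : ℝ)..η, kernelSlope η W z * G (x + z) := by
    have e : ∀ z, kernelSlope η W z * G (x + z) =
        -σ * (kernelSlope η W z * (h t (x + z) - vbar)) := fun z => by simp only [hG]; ring
    simp_rw [e]
    rw [intervalIntegral.integral_const_mul, S.kernel.lookAheadDeriv_eq hη hcont
      (S.localSpeed_horizon hX ht hξ.1.le le_rfl)]
    simp only [hG]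
    ring
  have hi : ∀ p q, IntervalIntegrable (fun z => kernelSlope η W z * G (x + z)) volume p q :=
    fun p q => Continuous.intervalIntegrable (by fun_prop) _ _
  -- Cutting the integral at the leader matters: it leaves the factor `W(β - x)` instead of `W(η)`,
  -- which may vanish.
  have htail : ∫ z in (leader b vbar t - x)..η, kernelSlope η W z * G (x + z) = 0 := by
    rw [← intervalIntegral.integral_zero (a := leader b vbar t - x) (b := η) (μ := volume)]
    refine intervalIntegral.integral_congr fun z hz => ?_
    rw [uIcc_of_le hlη] at hz
    simp only [hG]
    rw [hfront _ (by linarith [hz.1]), sub_self, mul_zero, mul_zero]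
  have hhead : (∫ z in (0 : ℝ)..(leader b vbar t - x), kernelSlope η W z) * G x ≤
      ∫ z in (0 : ℝ)..(leader b vbar t - x), kernelSlope η W z * G (x + z) := by
    rw [← intervalIntegral.integral_mul_const]
    refine intervalIntegral.integral_mono_on hl0 ((hkc.intervalIntegrable _ _).mul_const _)
      (hi _ _) fun z hz => ?_
    exact mul_le_mul_of_nonpos_left (hGle z hz.1) (S.kernel.slope_nonpos hη z)
  have hVge : W (leader b vbar t - leftBoundary b η vbar ρ t) * G x ≤
      σ * lookAheadDeriv η W (h t) x := by
    -- `x` lies to the right of `α(t)` and `W` is nonincreasing.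
    have h1 : W (leader b vbar t - leftBoundary b η vbar ρ t) ≤
        kernelExt η W (leader b vbar t - x) := by
      rw [← S.kernel.ext_eq hη (S.leader_sub_mem ht.1)]
      exact S.kernel.antitone_ext hη (by linarith)
    rw [hV, ← intervalIntegral.integral_add_adjacent_intervals (hi 0 _) (hi _ η), htail, add_zero]
    refine (mul_le_mul_of_nonneg_right h1 hGx).trans ?_
    rw [kernelExt, add_mul]
    linarith
  have hκ : 0 ≤ W (leader b vbar t - leftBoundary b η vbar ρ t) :=
    S.kernel.nonneg _ (S.leader_sub_mem ht.1)
  have hσ2 : σ * σ = 1 := by rcases hσ with rfl | rfl <;> norm_num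
  have h1 := mul_le_mul_of_nonneg_right hVge hρr
  have h2 := mul_le_mul_of_nonneg_left (S.velocity.sub_mul_sub_ge hw0 hd hr
    (hmem ξ hξ.1.le hξ.2.le)) hκ
  have h3 : W (leader b vbar t - leftBoundary b η vbar ρ t) * G x * (σ * (ρ t x - r)) =
      W (leader b vbar t - leftBoundary b η vbar ρ t) *
        ((v r w - v (ρ t x) w) * (ρ t x - r)) := by
    simp only [hG]
    rw [hx, hspeed ξ hξ.1.le hξ.2.le, hvr]
    linear_combination W (leader b vbar t - leftBoundary b η vbar ρ t) *
      ((vbar - v (ρ t (X t ξ)) w) * (ρ t (X t ξ) - r)) * hσ2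
  have h4 : σ * lookAheadDeriv η W (h t) x * (σ * (ρ t x - r)) =
      lookAheadDeriv η W (h t) x * (ρ t x - r) := by
    linear_combination lookAheadDeriv η W (h t) x * (ρ t x - r) * hσ2
  linarith

end IsRegularSolution

end

end NonlocalGARZ
end

theorem mainTheorem3
    (a b η vbar : ℝ) (hη : 0 < η) (hab : a + η < b) (hvbar : 0 < vbar)
    (W : ℝ → ℝ) (hW : NonlocalGARZ.IsKernel η W)
    (v : ℝ → ℝ → ℝ) (ρmax : ℝ → ℝ) (hv : NonlocalGARZ.IsVelocity v ρmax)
    (ρ₀ ω₀ : ℝ → ℝ) (hω₀ : ∀ x ∈ Set.Icc a b, vbar ≤ ω₀ x)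
    (ρ ω : ℝ → ℝ → ℝ)
    (hsol : NonlocalGARZ.IsSolution a b η vbar W v ρmax ρ₀ ω₀ ρ ω)
    (hreg : NonlocalGARZ.IsC1H2 ρ)
    (v'max : ℝ) (hv'max_neg : v'max < 0)
    (hv'max : ∀ x ∈ Set.Icc a b, ∀ r ∈ Set.Icc 0 (ρmax (ω₀ x)),
      derivWithin (fun s => v s (ω₀ x)) (Set.Icc 0 (ρmax (ω₀ x))) r ≤ v'max)
    (hcase :
      (∀ x ∈ Set.Icc 0 η, W x = 1 / η) ∨
      (ConcaveOn ℝ (Set.Icc 0 η) W ∧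
        ∃ w : ℝ, (∀ x ∈ Set.Icc (b - η) b, ω₀ x = w) ∧
          (((∀ x ∈ Set.Icc (b - η) b, NonlocalGARZ.eqDensity v ρmax vbar w ≤ ρ₀ x) ∧
              AntitoneOn ρ₀ (Set.Icc (b - η) b)) ∨
            ((∀ x ∈ Set.Icc (b - η) b, ρ₀ x ≤ NonlocalGARZ.eqDensity v ρmax vbar w) ∧
              MonotoneOn ρ₀ (Set.Icc (b - η) b))))) :
    ∀ t : ℝ, 0 ≤ t →
      NonlocalGARZ.lyapunov b η vbar v ρmax ρ ω t ≤
        NonlocalGARZ.lyapunov b η vbar v ρmax ρ ω 0 *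
          Real.exp (2 * v'max * NonlocalGARZ.rhoMin b η vbar v ρmax ρ ω *
            ∫ s in (0 : ℝ)..t,
              W (NonlocalGARZ.leader b vbar s - NonlocalGARZ.leftBoundary b η vbar ρ s)) := by
  intro t ht
  have S : NonlocalGARZ.IsRegularSolution a b η vbar W v ρmax ρ₀ ω₀ ρ ω :=
    ⟨hη, hab, hvbar, hW, hv, hω₀, hsol, hreg⟩
  obtain ⟨X, hX⟩ := S.exists_speedFlow ht
  refine S.lyapunov_le hX hv'max_neg hv'max (fun s hs ξ hξ => ?_) ⟨ht, le_rfl⟩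
  rcases hcase with hW1 | ⟨-, w, hw, hρ⟩
  · exact S.velocity_gradient_of_const hX hv'max hW1 hs hξ
  · rcases hρ with ⟨-, hρ⟩ | ⟨-, hρ⟩
    · exact S.velocity_gradient_of_monotone hX hv'max_neg.le hv'max (Or.inl rfl) hw
        (fun x hx y hy hxy => by linarith [hρ hx hy hxy]) hs hξ
    · exact S.velocity_gradient_of_monotone hX hv'max_neg.le hv'max (Or.inr rfl) hw
        (fun x hx y hy hxy => by linarith [hρ hx hy hxy]) hs hξ
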